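/- Let $Q=(q_i)_{i\ge1}$ be a basic sequence, i.e. a sequence of integers $q_i\ge 2$. Every real $x$ has a unique $Q$-Cantor series expansion $x=a_0+\sum_{i\ge1}\frac{a_i}{q_1\cdots q_i}$ with $a_0=\lfloor x\rfloor$, $a_i\in\{0,\dots,q_i-1\}$ for $i\ge1$, and $a_i\ne q_i-1$ for infinitely many $i$. For a block $B=(e_1,\dots,e_k)$ of non-negative integers let $N_n^Q(B,x)$ be the number of $i\in[1,n]$ with $(a_i,\dots,a_{i+k-1})=B$, and let $Q_n(B)=\sum_{j}\frac1{q_j\cdots q_{j+k-1}}$, the sum being over those $j\in[1,n]$ for which $e_1<q_j,\dots,e_k<q_{j+k-1}$. Let $\mathscr N(Q)$ ($Q$-normal numbers) be the set of all $x\in\mathbb R$ such that for every $k\ge1$ and every block $B$ of length $k$ with $Q_n(B)\to\infty$ we have $N_n^Q(B,x)/Q_n(B)\to1$. Let $\mathscr{RN}(Q)$ ($Q$-ratio normal numbers) be the set of all $x\in\mathbb R$ such that for every $k\ge1$ and all blocks $B_1,B_2$ of length $k$ with $\min(Q_n(B_1),Q_n(B_2))\to\infty$ we have $\frac{N_n^Q(B_1,x)/Q_n(B_1)}{N_n^Q(B_2,x)/Q_n(B_2)}\to1$.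 Let $\mathscr{DN}(Q)$ ($Q$-distribution normal numbers) be the set of all $x\in\mathbb R$ for which the sequence $(q_1\cdots q_n x \bmod 1)_{n\ge0}$ is uniformly distributed mod $1$. A set $D\subseteq\mathbb R$ is in the class $D_2(\mathbf\Pi^0_3)$ if $D=A\setminus B$ with $A,B\in\mathbf\Pi^0_3$, and $D$ is $D_2(\mathbf\Pi^0_3)$-complete if $D\in D_2(\mathbf\Pi^0_3)$ and $\mathbb R\setminus D\notin D_2(\mathbf\Pi^0_3)$. Theorem. Assume that $Q$ is infinite in limit, i.e. $q_i\to\infty$, and $1$-divergent, i.e. $\sum_{i=1}^\infty\frac1{q_i}=\infty$. Then the five sets $$\mathscr{DN}(Q)\setminus\mathscr N(Q),\quad \mathscr{DN}(Q)\setminus\mathscr{RN}(Q),\quad \mathscr N(Q)\setminus\mathscr{DN}(Q),\quad \mathscr{RN}(Q)\setminus\mathscr{DN}(Q),\quad \mathscr{RN}(Q)\setminus\mathscr N(Q)$$ are all $D_2(\mathbf\Pi^0_3)$-complete. -/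

import Mathlib

open Filter Topology

noncomputable section

namespace BorelHierarchy

/-- The finite levels of the Borel hierarchy: `SigmaZero n s` says that `s` is a boldface
`Σ⁰ₙ` subset of `X`. The `Σ⁰₁` sets are the open sets. For `n ≥ 2` the `Σ⁰ₙ` sets are the countable
unions of sets `A i`, each of which is `Π⁰` of some level `m i` with `1 ≤ m i < n`. (No set is at
level `0`, so the second clause yields nothing for `n ≤ 1`.) -/
inductive SigmaZero {X : Type*} [TopologicalSpace X] : ℕ → Set X → Prop
  | of_isOpen (s : Set X) (hs : IsOpen s) : SigmaZero 1 s
  | iUnion (n : ℕ) (m : ℕ → ℕ) (A : ℕ → Set X) (hm : ∀ i, m i < n)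
      (hA : ∀ i, SigmaZero (m i) (A i)ᶜ) : SigmaZero n (⋃ i, A i)

/-- `s` is `Π⁰ₙ`: its complement is `Σ⁰ₙ`. -/
def PiZero {X : Type*} [TopologicalSpace X] (n : ℕ) (s : Set X) : Prop :=
  SigmaZero n sᶜ

/-- `s` belongs to the class `D₂(Π⁰₃)` of differences of two `Π⁰₃` sets. -/
def IsD2Pi3 {X : Type*} [TopologicalSpace X] (s : Set X) : Prop :=
  ∃ A B : Set X, PiZero 3 A ∧ PiZero 3 B ∧ s = A \ B

/-- `s` is `D₂(Π⁰₃)`-hard: its complement is not in `D₂(Π⁰₃)`. -/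
def IsD2Pi3Hard {X : Type*} [TopologicalSpace X] (s : Set X) : Prop :=
  ¬ IsD2Pi3 sᶜ

/-- `s` is `D₂(Π⁰₃)`-complete: it is in `D₂(Π⁰₃)` and it is `D₂(Π⁰₃)`-hard. -/
def IsD2Pi3Complete {X : Type*} [TopologicalSpace X] (s : Set X) : Prop :=
  IsD2Pi3 s ∧ IsD2Pi3Hard s

end BorelHierarchy

namespace CantorSeries

/-! A basic sequence `q₁, q₂, …` is a function `Q : ℕ → ℕ` with all values at least `2`; the value
`Q i` is `q_{i+1}`. All positions are shifted by one in the same way: position `i` stands for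
position `i + 1` of the usual numbering, and the positions in `[1, n]` are those in `range n`. -/

/-- `Q` is a basic sequence: all its terms are at least `2`. -/
def IsBasicSequence (Q : ℕ → ℕ) : Prop := ∀ i, 2 ≤ Q i

/-- `Q` is infinite in limit. -/
def InfiniteInLimit (Q : ℕ → ℕ) : Prop := Tendsto Q atTop atTop

/-- The product `q₁ q₂ ⋯ qₙ`. -/
def partialProd (Q : ℕ → ℕ) (n : ℕ) : ℕ := ∏ i ∈ Finset.range n, Q i

/-- `T_{Q,n}(x) = (q₁ ⋯ qₙ) x mod 1`. -/
def T (Q : ℕ → ℕ) (n : ℕ) (x : ℝ) : ℝ := Int.fract ((partialProd Q n : ℝ) * x)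

/-- `a₀ + ∑ aᵢ / (q₁ ⋯ qᵢ)` is the `Q`-Cantor series expansion of `x`
(the digit `a i` is the one at position `i + 1`). -/
structure IsExpansion (Q : ℕ → ℕ) (x : ℝ) (a₀ : ℤ) (a : ℕ → ℕ) : Prop where
  floor_eq : a₀ = ⌊x⌋
  digit_lt : ∀ i, a i < Q i
  ne_infinitely_often : ∀ n, ∃ i, n ≤ i ∧ a i ≠ Q i - 1
  hasSum : HasSum (fun i => (a i : ℝ) / (partialProd Q (i + 1) : ℝ)) (x - a₀)

/-- The digits of the `Q`-Cantor series expansion of `x`, in closed form: the digit at position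
`n + 1` is `⌊q_{n+1} T_{Q,n}(x)⌋`. The theorem `isExpansion_iff` below shows that these are
the digits of the unique `Q`-Cantor series expansion of `x`. -/
def digit (Q : ℕ → ℕ) (x : ℝ) (n : ℕ) : ℕ := ⌊(Q n : ℝ) * T Q n x⌋₊

/-- `Q_n(B)` for a block `B` of length `k`: the expected number of occurrences of `B` with a
starting position in `[1, n]`. The summand is `0` where `B` is not an admissible block. -/
def expectedCount (Q : ℕ → ℕ) {k : ℕ} (B : Fin k → ℕ) (n : ℕ) : ℝ :=
  ∑ j ∈ Finset.range n,
    if ∀ t : Fin k, B t < Q (j + t) then 1 / ∏ t : Fin k, (Q (j + t) : ℝ) else 0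

/-- `Q_n^{(k)} = ∑_{j ≤ n} 1 / (q_j q_{j+1} ⋯ q_{j+k-1})`. -/
def divergenceSum (Q : ℕ → ℕ) (k n : ℕ) : ℝ :=
  ∑ j ∈ Finset.range n, 1 / ∏ t : Fin k, (Q (j + t) : ℝ)

/-- `Q` is `k`-divergent. -/
def KDivergent (Q : ℕ → ℕ) (k : ℕ) : Prop :=
  Tendsto (fun n => divergenceSum Q k n) atTop atTop

/-- `N_n^Q(B, x)`: the number of occurrences of the block `B` in the `Q`-Cantor series expansion
of `x` with a starting position in `[1, n]`. -/
def blockCount (Q : ℕ → ℕ) {k : ℕ} (B : Fin k → ℕ) (x : ℝ) (n : ℕ) : ℕ :=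
  ((Finset.range n).filter fun i => ∀ t : Fin k, digit Q x (i + t) = B t).card

/-- `x` is `Q`-normal of order `k`. -/
def IsNormalOfOrder (Q : ℕ → ℕ) (k : ℕ) (x : ℝ) : Prop :=
  ∀ B : Fin k → ℕ, Tendsto (fun n => expectedCount Q B n) atTop atTop →
    Tendsto (fun n => (blockCount Q B x n : ℝ) / expectedCount Q B n) atTop (𝓝 1)

/-- The set `N(Q)` of `Q`-normal numbers. -/
def NSet (Q : ℕ → ℕ) : Set ℝ := {x | ∀ k, 1 ≤ k → IsNormalOfOrder Q k x}

/-- `x` is `Q`-ratio normal of order `k`. (If `B₂` never occurs in `x`, the quotient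
is constantly `0` in Lean, so the condition fails, as it should.) -/
def IsRatioNormalOfOrder (Q : ℕ → ℕ) (k : ℕ) (x : ℝ) : Prop :=
  ∀ B₁ B₂ : Fin k → ℕ,
    Tendsto (fun n => min (expectedCount Q B₁ n) (expectedCount Q B₂ n)) atTop atTop →
    Tendsto (fun n => ((blockCount Q B₁ x n : ℝ) / expectedCount Q B₁ n) /
      ((blockCount Q B₂ x n : ℝ) / expectedCount Q B₂ n)) atTop (𝓝 1)

/-- The set `RN(Q)` of `Q`-ratio normal numbers. -/
def RNSet (Q : ℕ → ℕ) : Set ℝ := {x | ∀ k, 1 ≤ k → IsRatioNormalOfOrder Q k x}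

/-- The sequence `u` is uniformly distributed mod `1`: for all `0 ≤ a < b ≤ 1` the proportion of
the `n < N` with fractional part of `u n` in `[a, b)` tends to `b - a`. -/
def UniformlyDistributedModOne (u : ℕ → ℝ) : Prop :=
  ∀ a b : ℝ, 0 ≤ a → a < b → b ≤ 1 →
    Tendsto (fun N : ℕ =>
      (((Finset.range N).filter fun n => Int.fract (u n) ∈ Set.Ico a b).card : ℝ) / (N : ℝ))
      atTop (𝓝 (b - a))

/-- The set `DN(Q)` of `Q`-distribution normal numbers: the sequence `T_{Q,n}(x)`, `n ≥ 0`, is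
uniformly distributed mod `1`. -/
def DNSet (Q : ℕ → ℕ) : Set ℝ := {x | UniformlyDistributedModOne fun n => T Q n x}

/-! The digits are those of the unique Cantor series expansion. -/

theorem T_succ (Q : ℕ → ℕ) (n : ℕ) (x : ℝ) : (Q n : ℝ) * T Q n x = digit Q x n + T Q (n + 1) x := by
  have h0 : 0 ≤ (Q n : ℝ) * T Q n x := mul_nonneg (Nat.cast_nonneg _) (Int.fract_nonneg _)
  have h1 : T Q (n + 1) x = Int.fract ((Q n : ℝ) * T Q n x) := by
    unfold T partialProd
    rw [Int.fract_eq_fract]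
    refine ⟨Q n * ⌊((∏ i ∈ Finset.range n, Q i : ℕ) : ℝ) * x⌋, ?_⟩
    rw [Finset.prod_range_succ, Int.fract]
    push_cast
    ring
  rw [h1, digit, natCast_floor_eq_intCast_floor h0, Int.floor_add_fract]

theorem partialProd_succ (Q : ℕ → ℕ) (n : ℕ) :
    partialProd Q (n + 1) = partialProd Q n * Q n := Finset.prod_range_succ _ _

theorem two_pow_le_partialProd {Q : ℕ → ℕ} (hQ : IsBasicSequence Q) (n : ℕ) :
    2 ^ n ≤ partialProd Q n := by
  induction n with
  | zero => simp [partialProd]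
  | succ n ih => rw [partialProd_succ, pow_succ]; exact Nat.mul_le_mul ih (hQ n)

theorem partialProd_pos {Q : ℕ → ℕ} (hQ : IsBasicSequence Q) (n : ℕ) :
    (0 : ℝ) < partialProd Q n := by
  have := two_pow_le_partialProd hQ n
  have h2 : 0 < 2 ^ n := by positivity
  exact_mod_cast lt_of_lt_of_le h2 this

theorem tendsto_one_div_partialProd {Q : ℕ → ℕ} (hQ : IsBasicSequence Q) :
    Tendsto (fun n => 1 / (partialProd Q n : ℝ)) atTop (𝓝 0) := by
  refine squeeze_zero (fun n => (one_div_pos.2 (partialProd_pos hQ n)).le) (fun n => ?_)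
    (tendsto_pow_atTop_nhds_zero_of_lt_one (r := (1 / 2 : ℝ)) (by norm_num) (by norm_num))
  rw [one_div_pow]
  apply one_div_le_one_div_of_le (by positivity)
  exact_mod_cast two_pow_le_partialProd hQ n

theorem isExpansion_digit {Q : ℕ → ℕ} (hQ : IsBasicSequence Q) (x : ℝ) :
    IsExpansion Q x ⌊x⌋ (digit Q x) := by
  have hT0 : ∀ n, 0 ≤ T Q n x := fun n => Int.fract_nonneg _
  have hT1 : ∀ n, T Q n x < 1 := fun n => Int.fract_lt_one _
  have hq : ∀ n, (2 : ℝ) ≤ Q n := fun n => by exact_mod_cast hQ n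
  refine ⟨rfl, fun i => ?_, fun n => ?_, ?_⟩
  · have h := T_succ Q i x
    have : (digit Q x i : ℝ) < Q i := by nlinarith [hT0 i, hT1 i, hT0 (i + 1), hq i]
    exact_mod_cast this
  · by_contra! hcon
    have key : ∀ m, (2 : ℝ) ^ m * (1 - T Q n x) ≤ 1 - T Q (n + m) x := by
      intro m
      induction m with
      | zero => simp
      | succ m ih =>
        have h := T_succ Q (n + m) x
        have hd := hcon (n + m) (by omega)
        have hd' : (digit Q x (n + m) : ℝ) = Q (n + m) - 1 := by
          rw [hd, Nat.cast_sub (by have := hQ (n + m); omega)]; simp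
        rw [← add_assoc, pow_succ]
        nlinarith [hq (n + m), hT1 (n + m)]
    have hpos : 0 < 1 - T Q n x := by linarith [hT1 n]
    obtain ⟨m, hm⟩ := pow_unbounded_of_one_lt (1 / (1 - T Q n x)) (one_lt_two : (1 : ℝ) < 2)
    rw [div_lt_iff₀ hpos] at hm
    linarith [key m, hT0 (n + m)]
  · rw [hasSum_iff_tendsto_nat_of_nonneg (fun i => by positivity)]
    have hsum : ∀ n, ∑ i ∈ Finset.range n, (digit Q x i : ℝ) / (partialProd Q (i + 1) : ℝ)
        = (x - ⌊x⌋) - T Q n x * (1 / partialProd Q n) := by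
      intro n
      induction n with
      | zero => simp [T, partialProd]
      | succ n ih =>
        rw [Finset.sum_range_succ, ih, partialProd_succ]
        have h := T_succ Q n x
        have hp := (partialProd_pos hQ n).ne'
        have hqn : (Q n : ℝ) ≠ 0 := by linarith [hq n]
        have h' : (digit Q x n : ℝ) = Q n * T Q n x - T Q (n + 1) x := by linarith
        rw [h']
        push_cast
        field_simp
        ring
    simp only [hsum]
    have hz : Tendsto (fun n => T Q n x * (1 / (partialProd Q n : ℝ))) atTop (𝓝 0) := by
      refine squeeze_zero (fun n => mul_nonneg (hT0 n) (one_div_pos.2 (partialProd_pos hQ n)).le)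
        (fun n => ?_) (tendsto_one_div_partialProd hQ)
      exact mul_le_of_le_one_left (one_div_pos.2 (partialProd_pos hQ n)).le (hT1 n).le
    simpa using hz.const_sub (x - ⌊x⌋)

theorem IsExpansion.eq_digit {Q : ℕ → ℕ} (hQ : IsBasicSequence Q) {x : ℝ} {a₀ : ℤ} {a : ℕ → ℕ}
    (h : IsExpansion Q x a₀ a) : a = digit Q x := by
  have hq : ∀ n, (2 : ℝ) ≤ Q n := fun n => by exact_mod_cast hQ n
  have hP := partialProd_pos hQ
  have hle : ∀ i, (a i : ℝ) ≤ Q i - 1 := fun i => by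
    have : (a i : ℝ) + 1 ≤ Q i := by exact_mod_cast h.digit_lt i
    linarith
  set f : ℕ → ℝ := fun i => (a i : ℝ) / (partialProd Q (i + 1) : ℝ) with hf
  have hf0 : ∀ i, 0 ≤ f i := fun i => by positivity
  have hg : ∀ i, f i ≤ 1 / partialProd Q i - 1 / partialProd Q (i + 1) ∧
      (a i ≠ Q i - 1 → f i < 1 / partialProd Q i - 1 / partialProd Q (i + 1)) := by
    intro i
    have hp := hP i
    have hqi := hq i
    have e : (1 : ℝ) / partialProd Q i - 1 / partialProd Q (i + 1)
        = ((Q i : ℝ) - 1) / partialProd Q (i + 1) := by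
      rw [partialProd_succ]; push_cast; field_simp
    rw [e]
    refine ⟨div_le_div_of_nonneg_right (hle i) (hP _).le, fun hne => ?_⟩
    apply div_lt_div_of_pos_right _ (hP _)
    have : a i + 1 < Q i := by have := h.digit_lt i; omega
    have : (a i : ℝ) + 1 < Q i := by exact_mod_cast this
    linarith
  have hpart : ∀ n m, n ≤ m → ∑ i ∈ Finset.range m, f i ≤
      ∑ i ∈ Finset.range n, f i + 1 / partialProd Q n - 1 / partialProd Q m := by
    intro n m hnm
    induction m, hnm using Nat.le_induction with
    | base => linarith
    | succ m _ ih => rw [Finset.sum_range_succ]; linarith [(hg m).1]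
  have hlim := h.hasSum.tendsto_sum_nat
  have hlow : ∀ n, ∑ i ∈ Finset.range n, f i ≤ x - a₀ := fun n =>
    sum_le_hasSum _ (fun i _ => hf0 i) h.hasSum
  have hup' : ∀ n, x - a₀ ≤ ∑ i ∈ Finset.range n, f i + 1 / partialProd Q n := by
    intro n
    refine le_of_tendsto hlim ?_
    filter_upwards [eventually_ge_atTop n] with m hm
    linarith [hpart n m hm, one_div_pos.2 (hP m)]
  have hup : ∀ n, x - a₀ < ∑ i ∈ Finset.range n, f i + 1 / partialProd Q n := by
    intro n
    obtain ⟨i, hi, hne⟩ := h.ne_infinitely_often n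
    have h1 := hup' (i + 1)
    rw [Finset.sum_range_succ] at h1
    linarith [hpart n i hi, (hg i).2 hne]
  have hint : ∀ n, ∃ z : ℤ, (partialProd Q n : ℝ) * ∑ i ∈ Finset.range n, f i = z := by
    intro n
    induction n with
    | zero => exact ⟨0, by simp⟩
    | succ n ih =>
      obtain ⟨z, hz⟩ := ih
      refine ⟨Q n * z + a n, ?_⟩
      rw [Finset.sum_range_succ, mul_add, hf]
      have hp := (hP (n + 1)).ne'
      simp only [← hf]
      rw [mul_div_cancel₀ _ hp, partialProd_succ]
      push_cast
      rw [← hz]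
      ring
  have hT : ∀ n, T Q n x = partialProd Q n * (x - a₀ - ∑ i ∈ Finset.range n, f i) := by
    intro n
    obtain ⟨z, hz⟩ := hint n
    rw [T, Int.fract_eq_iff]
    refine ⟨mul_nonneg (hP n).le (by linarith [hlow n]), ?_, partialProd Q n * a₀ + z, ?_⟩
    · have := hup n
      rw [← lt_div_iff₀' (hP n)]
      linarith
    · push_cast
      rw [← hz]
      ring
  funext n
  have h1 := T_succ Q n x
  have h2 : (Q n : ℝ) * T Q n x = a n + T Q (n + 1) x := by
    rw [hT, hT, Finset.sum_range_succ, partialProd_succ]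
    have hp := (hP n).ne'
    have hqn : (Q n : ℝ) ≠ 0 := by linarith [hq n]
    simp only [hf, partialProd_succ]
    push_cast
    field_simp
    ring
  have h3 : (a n : ℝ) = digit Q x n := by linarith
  exact_mod_cast h3

/-- Every real number has exactly one `Q`-Cantor series expansion, with integer part `⌊x⌋`
and digits `digit Q x`. -/
theorem isExpansion_iff {Q : ℕ → ℕ} (hQ : IsBasicSequence Q) (x : ℝ) (a₀ : ℤ) (a : ℕ → ℕ) :
    IsExpansion Q x a₀ a ↔ a₀ = ⌊x⌋ ∧ a = digit Q x := by
  refine ⟨fun h => ⟨h.floor_eq, h.eq_digit hQ⟩, ?_⟩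
  rintro ⟨rfl, rfl⟩
  exact isExpansion_digit hQ x

end CantorSeries

end

/-! Upper bound. Each of the sets N(Q), RN(Q), DN(Q) is given by countably many conditions "from
some `n` on, an inequality holds" that involve finitely many digits or values `T Q i x`. These are
locally constant at irrational `x`, so the sets are `Π⁰₃` (`piZero_three_of_locally_decided`), and
the differences are in `D₂(Π⁰₃)`.

Hardness comes from a diagonal argument (`isD2Pi3Hard_of_continuous`). Membership of `z` in a `Π⁰₃`
set of sequences is equivalent to the divergence to infinity of numbers of which the `n`-th depends
only on the first `n` terms of `z` (`tendsto_leastChange_iff`). Suppose that `f` is continuous and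
`f z ∈ S` means that the first coordinate of `z` tends to infinity and the second does not. If `Sᶜ =
A \ B`, a sequence of pairs can be defined recursively whose coordinates are the numbers belonging
to `A` and `B` along itself. Its image lies in `A \ B` exactly if it lies in `S`, a contradiction.

It remains to code three sequences `x`, `y`, `z` continuously into one real number that is in DN(Q)
iff `x → ∞`, in RN(Q) iff `y → ∞`, and in N(Q) iff `y → ∞` and `z → ∞`. Take i.i.d. uniform `w j`
and the digits `⌊q w j⌋`; by a law of large numbers a fixed `w` has all the right block frequencies
(`exists_isGeneric`). Cut the positions into windows, each dominating everything before it. In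
window `m`, modify digits with frequency about `1 / (u m + 4)`, where `u` is `x`, `y` or `z`; the
modification is asymptotically negligible iff `u → ∞` (`expectedHits_isLittleO_iff`).

The three modifications (`newDigit`) hardly interact. For `x`, terms near `1` are moved to `1 / 2`:
this spoils the distribution but touches no fixed small digit eventually. For `y`, some digits `0`
become `1`, and for `z`, some digits below `√q` become `√q`: both shift `T` by `O(1 / √q) → 0`,
hence leave the distribution intact. The first changes the relative frequencies of blocks, the
second removes the same proportion of every block, so that only the ratios survive. The `y` and `z`
changes at `j` are triggered by `w (j + 1)` in an interval inside `[1 / 2, 1)`. Small digits come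
from terms below `1 / 2`, so eventually only the last digit of a block of fixed digits can be
affected, by a term independent of the block. This gives the exact count `ind_occurs_newDigit`. -/

namespace BorelHierarchy

/-! ### Borel classes: normal form of `Π⁰₃` sets and a membership criterion -/

section Basic

variable {X Y : Type*} [TopologicalSpace X] [TopologicalSpace Y]

theorem SigmaZero.cases_eq {n : ℕ} {s : Set X} (h : SigmaZero n s) :
    (n = 1 ∧ IsOpen s) ∨ ∃ (m : ℕ → ℕ) (A : ℕ → Set X), (∀ i, m i < n) ∧
      (∀ i, SigmaZero (m i) (A i)ᶜ) ∧ s = ⋃ i, A i := by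
  cases h with
  | of_isOpen s hs => exact Or.inl ⟨rfl, hs⟩
  | iUnion n m A hm hA => exact Or.inr ⟨m, A, hm, hA, rfl⟩

theorem SigmaZero.pos {n : ℕ} {s : Set X} (h : SigmaZero n s) : 0 < n := by
  rcases h.cases_eq with ⟨rfl, -⟩ | ⟨m, -, hm, -⟩
  · exact one_pos
  · exact (Nat.zero_le _).trans_lt (hm 0)

theorem SigmaZero.isOpen {s : Set X} (h : SigmaZero 1 s) : IsOpen s := by
  rcases h.cases_eq with ⟨-, h⟩ | ⟨m, A, hm, hA, -⟩
  · exact h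
  · have := (hA 0).pos
    have := hm 0
    omega

theorem SigmaZero.preimage {n : ℕ} {s : Set Y} (h : SigmaZero n s) {f : X → Y}
    (hf : Continuous f) : SigmaZero n (f ⁻¹' s) := by
  induction h with
  | of_isOpen s hs => exact .of_isOpen _ (hs.preimage hf)
  | iUnion n m A hm _ ih =>
    rw [Set.preimage_iUnion]
    exact .iUnion n m _ hm ih

theorem PiZero.preimage {n : ℕ} {s : Set Y} (h : PiZero n s) {f : X → Y} (hf : Continuous f) :
    PiZero n (f ⁻¹' s) :=
  SigmaZero.preimage h hf

theorem SigmaZero.exists_iUnion_isClosed [TopologicalSpace.MetrizableSpace X] {n : ℕ} {s : Set X}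
    (h : SigmaZero n s) (hn : n < 3) : ∃ F : ℕ → Set X, (∀ i, IsClosed (F i)) ∧ s = ⋃ i, F i := by
  rcases h.cases_eq with ⟨-, h⟩ | ⟨m, A, hm, hA, rfl⟩
  · let _ := TopologicalSpace.metrizableSpaceMetric X
    obtain ⟨F, hF, -, hU, -⟩ := h.exists_iUnion_isClosed
    exact ⟨F, hF, hU.symm⟩
  · refine ⟨A, fun i => ?_, rfl⟩
    have h1 : m i = 1 := by
      have := hm i
      have := (hA i).pos
      omega
    have := hA i
    rw [h1] at this
    exact isOpen_compl_iff.1 this.isOpen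

/-- Levels below `3` consist of `F_σ` sets, because open sets of a metrizable space are `F_σ`. This
normal form is all that the hardness argument uses about `Π⁰₃`. -/
theorem PiZero.exists_iInter_iUnion_isClosed [TopologicalSpace.MetrizableSpace X] {s : Set X}
    (h : PiZero 3 s) :
    ∃ F : ℕ → ℕ → Set X, (∀ k j, IsClosed (F k j)) ∧ s = ⋂ k, ⋃ j, F k j := by
  rcases SigmaZero.cases_eq h with ⟨h, -⟩ | ⟨m, A, hm, hA, hs⟩
  · omega
  · choose F hF hU using fun i => (hA i).exists_iUnion_isClosed (hm i)
    refine ⟨F, hF, ?_⟩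
    rw [← compl_compl s, hs, Set.compl_iUnion]
    exact Set.iInter_congr hU

/-- A set defined by conditions of the form `∀ k, ∃ N, ∀ n ≥ N, P k n x`, each `P k n` being
locally constant off a countable set, is `Π⁰₃`. -/
theorem piZero_three_of_locally_decided [T1Space X] {ι : Type*} [Countable ι]
    {E : Set X} (hE : E.Countable) (P : ι → ℕ → X → Prop)
    (hP : ∀ x ∉ E, ∀ k n, ∀ᶠ y in 𝓝 x, (P k n y ↔ P k n x)) :
    PiZero 3 {x | ∀ k, ∃ N, ∀ n ≥ N, P k n x} := by
  set S := {x | ∀ k, ∃ N, ∀ n ≥ N, P k n x} with hS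
  rcases isEmpty_or_nonempty X with hX | ⟨⟨x₀⟩⟩
  · have : Sᶜ = ⋃ _ : ℕ, (∅ : Set X) := Subsingleton.elim _ _
    unfold PiZero
    rw [this]
    exact .iUnion 3 (fun _ => 1) _ (by simp) fun _ => .of_isOpen _ (by simp)
  obtain ⟨r, hr⟩ : ∃ r : ℕ → X, E ⊆ Set.range r := by
    rcases E.eq_empty_or_nonempty with rfl | hne
    · exact ⟨fun _ => x₀, Set.empty_subset _⟩
    · obtain ⟨r, hr⟩ := hE.exists_eq_range hne
      exact ⟨r, hr.subset⟩
  -- Off `E` the conditions are relatively closed, so passing to closures makes them closed in `X`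
  -- at the price of errors on `E` only.
  have hcl : ∀ x ∉ E, ∀ k n, x ∈ closure {y | P k n y} ↔ P k n x := by
    intro x hx k n
    refine ⟨fun h => ?_, fun h => subset_closure h⟩
    obtain ⟨y, h1, h2⟩ := ((mem_closure_iff_frequently.1 h).and_eventually (hP x hx k n)).exists
    exact h2.1 h1
  let C : ι → ℕ → Set X := fun k N => ⋂ n ≥ N, closure {y | P k n y}
  have hC : ∀ k N, IsClosed (C k N) := fun k N =>
    isClosed_iInter fun _ => isClosed_iInter fun _ => isClosed_closure
  -- The errors on the countable set `E` are repaired point by point. Adding `D` makes each `F_σ`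
  -- set contain `S ∩ E`, and `D'` puts the points of `E \ S` into the complement.
  let D : ℕ → Set X := fun i => {r i} ∩ S
  have hD : ∀ i, IsClosed (D i) := fun i => (Set.finite_singleton _).inter_of_left S |>.isClosed
  let D' : ℕ → Set X := fun i => ({r i} ∩ E) \ S
  have hD' : ∀ i, IsClosed (D' i) := fun i =>
    (((Set.finite_singleton (r i)).inter_of_left E).subset Set.sdiff_subset).isClosed
  obtain ⟨e, he⟩ := exists_surjective_nat (Option ι ⊕ ℕ)
  let A : Option ι ⊕ ℕ → Set X := Sum.elim
    (fun o => o.elim ∅ fun k => (⋃ i : ℕ ⊕ ℕ, Sum.elim (C k) D i)ᶜ) D'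
  let m : Option ι ⊕ ℕ → ℕ := Sum.elim (fun o => o.elim 1 fun _ => 2) (fun _ => 1)
  have hA : ∀ i, SigmaZero (m i) (A i)ᶜ := by
    rintro ((_ | k) | i)
    · exact .of_isOpen _ (by simp [A])
    · simp only [A, m, Sum.elim_inl, Option.elim_some, compl_compl]
      obtain ⟨g, hg⟩ := exists_surjective_nat (ℕ ⊕ ℕ)
      rw [← hg.iUnion_comp]
      refine .iUnion 2 (fun _ => 1) _ (by simp) fun i => .of_isOpen _ ?_
      rw [isOpen_compl_iff]
      rcases g i with j | j
      · exact hC k j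
      · exact hD j
    · exact .of_isOpen _ (hD' i).isOpen_compl
  have hU : Sᶜ = ⋃ i, A (e i) := by
    rw [he.iUnion_comp A]
    ext x
    simp only [Set.mem_iUnion, Sum.exists, Option.exists, Set.mem_compl_iff]
    by_cases hx : x ∈ E
    · obtain ⟨i, rfl⟩ := hr hx
      constructor
      · intro h
        exact Or.inr ⟨i, ⟨rfl, hx⟩, h⟩
      · rintro ((h | ⟨k, h⟩) | ⟨j, -, h⟩)
        · exact h.elim
        · intro h'
          exact h (Set.mem_iUnion.2 ⟨Sum.inr i, rfl, h'⟩)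
        · exact h
    · have key : ∀ k, x ∈ (⋃ i : ℕ ⊕ ℕ, Sum.elim (C k) D i) ↔ x ∈ S ∨ ∃ N, ∀ n ≥ N, P k n x := by
        intro k
        simp only [Set.mem_iUnion, Sum.exists, Sum.elim_inl, Sum.elim_inr]
        constructor
        · rintro (⟨N, h⟩ | ⟨i, -, h⟩)
          · right
            refine ⟨N, fun n hn => (hcl x hx k n).1 ?_⟩
            exact Set.mem_iInter₂.1 h n hn
          · exact Or.inl h
        · rintro (h | ⟨N, h⟩)
          · obtain ⟨N, h⟩ := h k
            exact Or.inl ⟨N, Set.mem_iInter₂.2 fun n hn => (hcl x hx k n).2 (h n hn)⟩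
          · exact Or.inl ⟨N, Set.mem_iInter₂.2 fun n hn => (hcl x hx k n).2 (h n hn)⟩
      constructor
      · intro h
        obtain ⟨k, hk⟩ := not_forall.1 h
        refine Or.inl (Or.inr ⟨k, fun h' => ?_⟩)
        rcases (key k).1 h' with h' | h'
        · exact h h'
        · exact hk h'
      · rintro ((h | ⟨k, h⟩) | ⟨j, h, -⟩)
        · exact h.elim
        · exact fun h' => h ((key k).2 (Or.inl h'))
        · exact (hx h.2).elim
  unfold PiZero
  rw [hU]
  refine .iUnion 3 (fun i => m (e i)) _ (fun i => ?_) fun i => hA _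
  rcases e i with (_ | k) | i <;> simp [m]

end Basic

/-! ### Diagonalization: approximations of `Π⁰₃` sets and a self-referential sequence -/

section Hardness

variable {α : Type*}

/-- The least index `j` for which `F j` has not been separated from `z` by its first `n` terms,
cut off at `n`. -/
noncomputable def leastIndex (F : ℕ → Set (ℕ → α)) (n : ℕ) (z : ℕ → α) : ℕ :=
  sInf {j | n ≤ j ∨ (F j ∩ PiNat.cylinder z n).Nonempty}

theorem leastIndex_mem (F : ℕ → Set (ℕ → α)) (n : ℕ) (z : ℕ → α) :
    n ≤ leastIndex F n z ∨ (F (leastIndex F n z) ∩ PiNat.cylinder z n).Nonempty :=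
  Nat.sInf_mem (s := {j | n ≤ j ∨ (F j ∩ PiNat.cylinder z n).Nonempty}) ⟨n, Or.inl le_rfl⟩

theorem leastIndex_mono (F : ℕ → Set (ℕ → α)) (z : ℕ → α) :
    Monotone fun n => leastIndex F n z := by
  intro a b hab
  apply Nat.sInf_le
  rcases leastIndex_mem F b z with h | h
  · exact Or.inl (hab.trans h)
  · exact Or.inr (h.mono (Set.inter_subset_inter_right _ (PiNat.cylinder_anti z hab)))

theorem leastIndex_le {F : ℕ → Set (ℕ → α)} {z : ℕ → α} {j : ℕ} (h : z ∈ F j) (n : ℕ) :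
    leastIndex F n z ≤ j :=
  Nat.sInf_le (Or.inr ⟨z, h, PiNat.self_mem_cylinder z n⟩)

theorem exists_leastIndex_eq {F : ℕ → Set (ℕ → α)} {z : ℕ → α} {b : ℕ}
    (h : ∀ n, leastIndex F n z ≤ b) : ∃ N j, ∀ n ≥ N, leastIndex F n z = j := by
  obtain ⟨N, hN⟩ : ∃ N, ∀ n, leastIndex F n z ≤ leastIndex F N z := by
    have hfin : (Set.range fun n => leastIndex F n z).Finite :=
      (Set.finite_Iic b).subset (by rintro _ ⟨n, rfl⟩; exact h n)
    obtain ⟨_, ⟨N, rfl⟩, hN⟩ := Set.exists_max_image _ id hfin (Set.range_nonempty _)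
    exact ⟨N, fun n => hN _ ⟨n, rfl⟩⟩
  exact ⟨N, _, fun n hn => le_antisymm (hN n) (leastIndex_mono F z hn)⟩

/-- A bounded monotone index stabilizes at some `j`, so `F j` meets every cylinder around `z`; being
closed, it contains `z`. -/
theorem mem_of_leastIndex_bounded [TopologicalSpace α] [DiscreteTopology α]
    {F : ℕ → Set (ℕ → α)} (hF : ∀ j, IsClosed (F j)) {z : ℕ → α}
    {b : ℕ} (h : ∀ n, leastIndex F n z ≤ b) : z ∈ ⋃ j, F j := by
  obtain ⟨N, j, hj⟩ := exists_leastIndex_eq h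
  refine Set.mem_iUnion.2 ⟨j, ?_⟩
  by_contra hz
  obtain ⟨n, hn⟩ := PiNat.exists_disjoint_cylinder (hF j) hz
  -- A stage beyond `j` rules out that the value `j` is only due to the cut-off.
  have h1 := leastIndex_mem F (max (max N n) (j + 1)) z
  rw [hj _ (by omega)] at h1
  rcases h1 with h1 | ⟨w, hw, hw'⟩
  · omega
  · exact Set.disjoint_left.1 hn hw (PiNat.cylinder_anti z (by omega) hw')

/-- The least `k` such that the approximation for `F k` changes at stage `n`, cut off at `n`. -/
noncomputable def leastChange (F : ℕ → ℕ → Set (ℕ → α)) (n : ℕ) (z : ℕ → α) : ℕ :=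
  sInf {k | n ≤ k ∨ leastIndex (F k) n z ≠ leastIndex (F k) (n - 1) z}

/-- Only cylinders of length at most `n` enter; this is what permits the recursive definition of a
sequence in terms of its own approximations. -/
theorem leastChange_congr (F : ℕ → ℕ → Set (ℕ → α)) (n : ℕ) {z z' : ℕ → α}
    (h : ∀ i < n, z i = z' i) : leastChange F n z = leastChange F n z' := by
  have h1 : ∀ m ≤ n, PiNat.cylinder z m = PiNat.cylinder z' m := fun m hm =>
    PiNat.mem_cylinder_iff_eq.1 (PiNat.mem_cylinder_iff.2 fun i hi => h i (hi.trans_le hm))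
  simp only [leastChange, leastIndex, h1 n le_rfl, h1 (n - 1) (Nat.sub_le _ _)]

/-- The numbers tend to infinity iff, for each `k`, the index for `F k` changes only finitely often.
As this index is monotone in the stage, that means it is bounded, which happens iff `z` lies in some
`F k j`. -/
theorem tendsto_leastChange_iff [TopologicalSpace α] [DiscreteTopology α]
    {F : ℕ → ℕ → Set (ℕ → α)} (hF : ∀ k j, IsClosed (F k j))
    (z : ℕ → α) :
    Tendsto (fun n => leastChange F n z) atTop atTop ↔ z ∈ ⋂ k, ⋃ j, F k j := by
  constructor
  · intro h
    refine Set.mem_iInter.2 fun k => ?_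
    obtain ⟨N, hN⟩ := eventually_atTop.1 (h.eventually_gt_atTop k)
    refine mem_of_leastIndex_bounded (hF k) (b := leastIndex (F k) N z) fun n => ?_
    rcases le_total n N with hn | hn
    · exact leastIndex_mono (F k) z hn
    · induction n, hn using Nat.le_induction with
      | base => exact le_rfl
      | succ n hn ih =>
        have h1 : k ∉ {k | n + 1 ≤ k ∨ leastIndex (F k) (n + 1) z ≠ leastIndex (F k) (n + 1 - 1) z} :=
          Nat.notMem_of_lt_sInf (hN (n + 1) (by omega))
        simp only [Set.mem_ofPred_eq, not_or, not_not, Nat.add_sub_cancel] at h1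
        rw [h1.2]
        exact ih
  · intro h
    have h1 : ∀ k, ∃ N j, ∀ n ≥ N, leastIndex (F k) n z = j := fun k => by
      obtain ⟨j, hj⟩ := Set.mem_iUnion.1 (Set.mem_iInter.1 h k)
      exact exists_leastIndex_eq fun n => leastIndex_le hj n
    choose N j hN using h1
    refine tendsto_atTop.2 fun K => ?_
    have h2 : ∀ᶠ n in atTop, ∀ k ∈ Finset.range K, N k + 1 ≤ n :=
      (Finset.eventually_all _).2 fun k _ => eventually_ge_atTop _
    filter_upwards [h2, eventually_ge_atTop K] with n hn hK
    refine le_csInf ⟨n, Or.inl le_rfl⟩ fun k hk => ?_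
    by_contra! hlt
    have := hn k (Finset.mem_range.2 hlt)
    rcases hk with hk | hk
    · omega
    · exact hk ((hN k n (by omega)).trans (hN k (n - 1) (by omega)).symm)

theorem exists_fixed_sequence {α : Type*} [Inhabited α] (G : ℕ → (ℕ → α) → α)
    (hG : ∀ n z z', (∀ i < n, z i = z' i) → G n z = G n z') : ∃ z : ℕ → α, ∀ n, z n = G n z := by
  let z : ℕ → α := fun n => Nat.strongRec (motive := fun _ => α)
    (fun n ih => G n fun i => if h : i < n then ih i h else default) n
  refine ⟨z, fun n => ?_⟩
  have h1 : z n = G n fun i => if _ : i < n then z i else default := by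
    simp only [z]
    rw [Nat.strongRec]
  rw [h1]
  exact hG n _ _ fun i hi => by simp [hi]

/-- The set of pairs of sequences of which the first one tends to infinity and the second one does
not is `D₂(Π⁰₃)`-hard, and so is every set to which it reduces continuously. -/
theorem isD2Pi3Hard_of_continuous {X : Type*} [TopologicalSpace X] {S : Set X}
    (f : (ℕ → ℕ × ℕ) → X) (hf : Continuous f)
    (hS : ∀ z, f z ∈ S ↔ Tendsto (fun n => (z n).1) atTop atTop ∧
      ¬ Tendsto (fun n => (z n).2) atTop atTop) : IsD2Pi3Hard S := by
  rintro ⟨A, B, hA, hB, hAB⟩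
  obtain ⟨F, hF, hFA⟩ := (hA.preimage hf).exists_iInter_iUnion_isClosed
  obtain ⟨G, hG, hGB⟩ := (hB.preimage hf).exists_iInter_iUnion_isClosed
  -- The diagonal sequence: its two coordinates test its own membership in the preimages of `A` and
  -- `B`.
  obtain ⟨z, hz⟩ := exists_fixed_sequence (fun n z => (leastChange F n z, leastChange G n z))
    fun n z z' h => by rw [leastChange_congr F n h, leastChange_congr G n h]
  have h1 : f z ∈ A ↔ Tendsto (fun n => (z n).1) atTop atTop := by
    rw [← Set.mem_preimage, hFA, ← tendsto_leastChange_iff hF]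
    exact iff_of_eq (congrArg (Tendsto · _ _) (funext fun n => by rw [hz n]))
  have h2 : f z ∈ B ↔ Tendsto (fun n => (z n).2) atTop atTop := by
    rw [← Set.mem_preimage, hGB, ← tendsto_leastChange_iff hG]
    exact iff_of_eq (congrArg (Tendsto · _ _) (funext fun n => by rw [hz n]))
  have h3 : f z ∈ Sᶜ ↔ f z ∈ S := by
    rw [hAB, Set.mem_sdiff, h1, h2, hS]
  exact (iff_not_self (h3.symm.trans (Set.mem_compl_iff _ _)))

end Hardness

end BorelHierarchy

/-! ### A strong law of large numbers for events with finite-range dependence -/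

section Counting

open MeasureTheory

/-- If the monotone sequences `N` and `s` are asymptotic along the times at which `s` passes the
squares, and `s` has bounded increments, then they are asymptotic. -/
theorem tendsto_div_of_tendsto_squares {N s : ℕ → ℝ} (hN : Monotone N) (hs : Monotone s)
    (hN0 : ∀ n, 0 ≤ N n) (hs0 : s 0 = 0) (hs1 : ∀ n, s (n + 1) ≤ s n + 1) {φ : ℕ → ℕ}
    (hφ : ∀ r : ℕ, (r : ℝ) ^ 2 ≤ s (φ r)) (hφ' : ∀ r : ℕ, ∀ n < φ r, s n < (r : ℝ) ^ 2)
    (htop : Tendsto s atTop atTop)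
    (h : Tendsto (fun r => N (φ r) / s (φ r)) atTop (𝓝 1)) :
    Tendsto (fun n => N n / s n) atTop (𝓝 1) := by
  have hsn : ∀ n, 0 ≤ s n := fun n => hs0 ▸ hs (Nat.zero_le n)
  have hub : ∀ r : ℕ, s (φ r) ≤ (r : ℝ) ^ 2 + 1 := by
    intro r
    rcases Nat.eq_zero_or_pos (φ r) with h0 | h0
    · rw [h0, hs0]; positivity
    · have h1 := hφ' r (φ r - 1) (by omega)
      have h2 := hs1 (φ r - 1)
      rw [Nat.sub_add_cancel h0] at h2
      linarith
  -- Thus `n` lies between `φ (R n)` and `φ (R n + 1)`. By bounded increments `s` exceeds the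
  -- squares there by at most `1`, and quotients of consecutive squares tend to `1`, so monotonicity
  -- sandwiches `N n / s n`.
  let R : ℕ → ℕ := fun n => ⌊√(s n)⌋₊
  have hRtop : Tendsto R atTop atTop :=
    tendsto_nat_floor_atTop.comp (Real.tendsto_sqrt_atTop.comp htop)
  have hR1 : ∀ n, (R n : ℝ) ^ 2 ≤ s n := fun n => by
    have := Nat.floor_le (Real.sqrt_nonneg (s n))
    calc (R n : ℝ) ^ 2 ≤ √(s n) ^ 2 := by gcongr
      _ = s n := Real.sq_sqrt (hsn n)
  have hR2 : ∀ n, s n < ((R n : ℝ) + 1) ^ 2 := fun n => by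
    have := Nat.lt_floor_add_one (√(s n))
    calc s n = √(s n) ^ 2 := (Real.sq_sqrt (hsn n)).symm
      _ < ((R n : ℝ) + 1) ^ 2 := by gcongr
  have hle1 : ∀ n, φ (R n) ≤ n := fun n => by
    by_contra! hlt
    exact absurd (hφ' _ _ hlt) (not_lt.2 (hR1 n))
  have hle2 : ∀ n, n ≤ φ (R n + 1) := fun n => by
    by_contra! hlt
    have h1 := hφ (R n + 1)
    have h2 := hs hlt.le
    have h3 := hR2 n
    push_cast at h1
    linarith
  have hcast : Tendsto (fun r : ℕ => (r : ℝ)) atTop atTop := tendsto_natCast_atTop_atTop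
  have hinv : Tendsto (fun r : ℕ => ((r : ℝ))⁻¹) atTop (𝓝 0) := tendsto_inv_atTop_zero.comp hcast
  have hlow : Tendsto (fun r : ℕ => (N (φ r) / s (φ r)) * ((r : ℝ) ^ 2 / ((r : ℝ) + 1) ^ 2))
      atTop (𝓝 1) := by
    have h2 : Tendsto (fun r : ℕ => (1 : ℝ) / (1 + ((r : ℝ))⁻¹) ^ 2) atTop (𝓝 (1 / (1 + 0) ^ 2)) :=
      tendsto_const_nhds.div ((hinv.const_add 1).pow 2) (by norm_num)
    have h3 : Tendsto (fun r : ℕ => (r : ℝ) ^ 2 / ((r : ℝ) + 1) ^ 2) atTop (𝓝 1) := by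
      have := h2.congr' (f₂ := fun r : ℕ => (r : ℝ) ^ 2 / ((r : ℝ) + 1) ^ 2) (by
        filter_upwards [eventually_gt_atTop 0] with r hr
        have : (0 : ℝ) < r := by exact_mod_cast hr
        field_simp)
      simpa using this
    simpa using h.mul h3
  have hupp : Tendsto (fun r : ℕ => (N (φ (r + 1)) / s (φ (r + 1))) *
      ((((r : ℝ) + 1) ^ 2 + 1) / (r : ℝ) ^ 2)) atTop (𝓝 1) := by
    have h2 : Tendsto (fun r : ℕ => (1 + ((r : ℝ))⁻¹) ^ 2 + (((r : ℝ))⁻¹) ^ 2) atTop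
        (𝓝 ((1 + 0) ^ 2 + 0 ^ 2)) := ((hinv.const_add 1).pow 2).add (hinv.pow 2)
    have h3 : Tendsto (fun r : ℕ => (((r : ℝ) + 1) ^ 2 + 1) / (r : ℝ) ^ 2) atTop (𝓝 1) := by
      have := h2.congr' (f₂ := fun r : ℕ => (((r : ℝ) + 1) ^ 2 + 1) / (r : ℝ) ^ 2) (by
        filter_upwards [eventually_gt_atTop 0] with r hr
        have : (0 : ℝ) < r := by exact_mod_cast hr
        field_simp)
      simpa using this
    simpa using (h.comp (tendsto_add_atTop_nat 1)).mul h3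
  refine tendsto_of_tendsto_of_tendsto_of_le_of_le' (hlow.comp hRtop) (hupp.comp hRtop) ?_ ?_
  · filter_upwards [hRtop.eventually_gt_atTop 0] with n hn
    have hr : (0 : ℝ) < R n := by exact_mod_cast hn
    have h1 : 0 < s (φ (R n)) := lt_of_lt_of_le (by positivity) (hφ (R n))
    have h2 : 0 < s n := lt_of_lt_of_le (by positivity) (hR1 n)
    simp only [Function.comp]
    rw [div_mul_div_comm, div_le_div_iff₀ (by positivity) h2]
    have h3 := hN (hle1 n)
    have h4 := hR2 n
    have h5 := hφ (R n)
    calc N (φ (R n)) * (R n : ℝ) ^ 2 * s n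
        ≤ N n * s (φ (R n)) * ((R n : ℝ) + 1) ^ 2 := by
          have := hN0 (φ (R n))
          have := hN0 n
          gcongr
      _ = _ := by ring
  · filter_upwards [hRtop.eventually_gt_atTop 0] with n hn
    have hr : (0 : ℝ) < R n := by exact_mod_cast hn
    have h1 : 0 < s (φ (R n + 1)) := lt_of_lt_of_le (by positivity) (hφ (R n + 1))
    have h2 : 0 < s n := lt_of_lt_of_le (by positivity) (hR1 n)
    simp only [Function.comp]
    rw [div_mul_div_comm, div_le_div_iff₀ h2 (by positivity)]
    have h3 := hN (hle2 n)
    have h4 := hub (R n + 1)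
    push_cast at h4
    have := hN0 (φ (R n + 1))
    calc N n * (s (φ (R n + 1)) * (R n : ℝ) ^ 2)
        ≤ N (φ (R n + 1)) * ((((R n : ℝ) + 1) ^ 2 + 1) * s n) := by
          have := hR1 n
          gcongr
      _ = _ := by ring

variable {Ω : Type*} [MeasurableSpace Ω] {μ : Measure Ω}

theorem integrable_indicator_sub_mul [IsProbabilityMeasure μ] {A B : Set Ω}
    (hA : MeasurableSet A) (hB : MeasurableSet B)
    (a b : ℝ) :
    Integrable (fun ω => (A.indicator 1 ω - a) * (B.indicator 1 ω - b)) μ := by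
  have hA' : Measurable (A.indicator (1 : Ω → ℝ)) := measurable_one.indicator hA
  have hB' : Measurable (B.indicator (1 : Ω → ℝ)) := measurable_one.indicator hB
  refine Integrable.of_bound ((hA'.sub_const a).mul (hB'.sub_const b)).aestronglyMeasurable
    ((1 + |a|) * (1 + |b|)) (Eventually.of_forall fun ω => ?_)
  have key : ∀ (C : Set Ω) (c : ℝ), |C.indicator 1 ω - c| ≤ 1 + |c| := fun C c => by
    refine (abs_sub _ _).trans (add_le_add ?_ le_rfl)
    by_cases h : ω ∈ C <;> simp [h]
  rw [Real.norm_eq_abs, abs_mul]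
  exact mul_le_mul (key A a) (key B b) (abs_nonneg _) (by positivity)

theorem integral_indicator_sub_mul [IsProbabilityMeasure μ] {A B : Set Ω}
    (hA : MeasurableSet A) (hB : MeasurableSet B) :
    ∫ ω, (A.indicator 1 ω - μ.real A) * (B.indicator 1 ω - μ.real B) ∂μ =
      μ.real (A ∩ B) - μ.real A * μ.real B := by
  have e : ∀ ω, (A.indicator (1 : Ω → ℝ) ω - μ.real A) * (B.indicator 1 ω - μ.real B) =
      (A ∩ B).indicator 1 ω - μ.real B * A.indicator 1 ω - μ.real A * B.indicator 1 ω
        + μ.real A * μ.real B := by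
    intro ω
    by_cases h1 : ω ∈ A <;> by_cases h2 : ω ∈ B <;> simp [h1, h2] <;> ring
  have hi : ∀ C : Set Ω, MeasurableSet C → Integrable (C.indicator (1 : Ω → ℝ)) μ := fun C hC =>
    (integrable_const (1 : ℝ)).indicator hC
  simp only [e]
  rw [integral_add, integral_sub, integral_sub, integral_const_mul, integral_const_mul,
    integral_indicator_one hA, integral_indicator_one hB, integral_indicator_one (hA.inter hB)]
  · simp
    ring
  · exact hi _ (hA.inter hB)
  · exact (hi _ hA).const_mul _
  · exact (hi _ (hA.inter hB)).sub ((hi _ hA).const_mul _)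
  · exact (hi _ hB).const_mul _
  · exact ((hi _ (hA.inter hB)).sub ((hi _ hA).const_mul _)).sub ((hi _ hB).const_mul _)
  · exact integrable_const _

/-- In the expanded square the covariances at distance at least `m` vanish. For each `i` at most `2
* m` others remain, each at most `μ.real (A i)`. -/
theorem integral_sq_count_sub_le [IsProbabilityMeasure μ] {A : ℕ → Set Ω}
    (hA : ∀ i, MeasurableSet (A i)) {m : ℕ}
    (hind : ∀ i j, i + m ≤ j → μ.real (A i ∩ A j) = μ.real (A i) * μ.real (A j)) (n : ℕ) :
    ∫ ω, (∑ i ∈ Finset.range n, ((A i).indicator 1 ω - μ.real (A i))) ^ 2 ∂μ ≤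
      2 * m * ∑ i ∈ Finset.range n, μ.real (A i) := by
  simp only [sq, Finset.sum_mul_sum]
  rw [integral_finsetSum _ fun i _ => integrable_finsetSum _ fun j _ =>
    integrable_indicator_sub_mul (hA i) (hA j) _ _, Finset.mul_sum]
  refine Finset.sum_le_sum fun i _ => ?_
  rw [integral_finsetSum _ fun j _ => integrable_indicator_sub_mul (hA i) (hA j) _ _]
  have h1 : ∀ j ∈ Finset.range n,
      ∫ ω, ((A i).indicator 1 ω - μ.real (A i)) * ((A j).indicator 1 ω - μ.real (A j)) ∂μ ≤
      if j ∈ Finset.Ico (i + 1 - m) (i + m) then μ.real (A i) else 0 := by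
    intro j _
    rw [integral_indicator_sub_mul (hA i) (hA j)]
    split_ifs with h
    · have : μ.real (A i ∩ A j) ≤ μ.real (A i) := measureReal_mono Set.inter_subset_left
      have : 0 ≤ μ.real (A i) * μ.real (A j) := by positivity
      linarith
    · rw [Finset.mem_Ico, not_and_or] at h
      rcases le_or_gt (i + m) j with hj | hj
      · rw [hind i j hj, sub_self]
      · rw [Set.inter_comm, hind j i (by omega), mul_comm, sub_self]
  refine (Finset.sum_le_sum h1).trans ?_
  rw [← Finset.sum_filter, Finset.sum_const, nsmul_eq_mul]
  refine mul_le_mul_of_nonneg_right ?_ measureReal_nonneg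
  have : (Finset.filter (· ∈ Finset.Ico (i + 1 - m) (i + m)) (Finset.range n)).card ≤ 2 * m := by
    refine (Finset.card_le_card (t := Finset.Ico (i + 1 - m) (i + m)) fun j hj =>
      (Finset.mem_filter.1 hj).2).trans ?_
    rw [Nat.card_Ico]
    omega
  exact_mod_cast this

/-- The integral of `∑ f r` is finite, so the series converges almost everywhere. This replaces
Chebyshev's inequality and the Borel–Cantelli lemma. -/
theorem ae_tendsto_zero_of_summable_integral {f : ℕ → Ω → ℝ} (hf : ∀ r, Measurable (f r))
    (hf0 : ∀ r ω, 0 ≤ f r ω) (hfi : ∀ r, Integrable (f r) μ)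
    (h : Summable fun r => ∫ ω, f r ω ∂μ) : ∀ᵐ ω ∂μ, Tendsto (fun r => f r ω) atTop (𝓝 0) := by
  have h1 : ∫⁻ ω, ∑' r, ENNReal.ofReal (f r ω) ∂μ ≠ ⊤ := by
    rw [lintegral_tsum fun r => (hf r).ennreal_ofReal.aemeasurable]
    simp only [← ofReal_integral_eq_lintegral_ofReal (hfi _) (Eventually.of_forall (hf0 _))]
    exact h.tsum_ofReal_ne_top
  filter_upwards [ae_lt_top (Measurable.tsum fun r => (hf r).ennreal_ofReal) h1] with ω hω
  have h2 := ENNReal.tendsto_atTop_zero_of_tsum_ne_top hω.ne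
  have h3 := (ENNReal.tendsto_toReal ENNReal.zero_ne_top).comp h2
  simpa [Function.comp_def, ENNReal.toReal_ofReal (hf0 _ ω)] using h3

/-- The strong law of large numbers for the number of events that occur, in a sequence of events
of which any two at distance at least `m` are independent. -/
theorem ae_tendsto_count_div [IsProbabilityMeasure μ] {A : ℕ → Set Ω}
    (hA : ∀ i, MeasurableSet (A i)) {m : ℕ}
    (hind : ∀ i j, i + m ≤ j → μ.real (A i ∩ A j) = μ.real (A i) * μ.real (A j))
    (hdiv : Tendsto (fun n => ∑ i ∈ Finset.range n, μ.real (A i)) atTop atTop) :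
    ∀ᵐ ω ∂μ, Tendsto (fun n => (∑ i ∈ Finset.range n, (A i).indicator (1 : Ω → ℝ) ω) /
      ∑ i ∈ Finset.range n, μ.real (A i)) atTop (𝓝 1) := by
  classical
  set s : ℕ → ℝ := fun n => ∑ i ∈ Finset.range n, μ.real (A i) with hs
  have hex : ∀ r : ℕ, ∃ n, (r : ℝ) ^ 2 ≤ s n := fun r => (hdiv.eventually_ge_atTop _).exists
  let φ : ℕ → ℕ := fun r => Nat.find (hex r)
  have hφ : ∀ r : ℕ, (r : ℝ) ^ 2 ≤ s (φ r) := fun r => Nat.find_spec (hex r)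
  have hφ' : ∀ r : ℕ, ∀ n < φ r, s n < (r : ℝ) ^ 2 := fun r n hn => not_le.1 (Nat.find_min _ hn)
  let g : ℕ → Ω → ℝ := fun n ω => ∑ i ∈ Finset.range n, ((A i).indicator 1 ω - μ.real (A i))
  have hgm : ∀ n, Measurable (g n) := fun n => Finset.measurable_fun_sum _ fun i _ =>
    (measurable_one.indicator (hA i)).sub_const _
  have hgi : ∀ n, Integrable (fun ω => g n ω ^ 2) μ := fun n => by
    simp only [g, sq, Finset.sum_mul_sum]
    exact integrable_finsetSum _ fun i _ => integrable_finsetSum _ fun j _ =>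
      integrable_indicator_sub_mul (hA i) (hA j) _ _
  -- The variance bound divided by the squared mean is at most `2 * m / s (φ r) ≤ 2 * m / r ^ 2`;
  -- this is why the times at which `s` passes the squares are chosen.
  have hsum : Summable fun r => ∫ ω, g (φ r) ω ^ 2 / s (φ r) ^ 2 ∂μ := by
    refine Summable.of_nonneg_of_le (fun r => integral_nonneg fun ω => by positivity)
      (fun r => ?_) ((Real.summable_one_div_nat_pow.2 one_lt_two).mul_left (2 * (m : ℝ)))
    rw [integral_div]
    have h1 : ∫ ω, g (φ r) ω ^ 2 ∂μ ≤ 2 * m * s (φ r) := integral_sq_count_sub_le hA hind _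
    rcases Nat.eq_zero_or_pos r with rfl | hr
    · have : φ 0 = 0 := by simp [φ, hs]
      simp [this, g]
    have hr' : (0 : ℝ) < r := by exact_mod_cast hr
    have h2 := hφ r
    have h3 : 0 < s (φ r) := lt_of_lt_of_le (by positivity) h2
    calc (∫ ω, g (φ r) ω ^ 2 ∂μ) / s (φ r) ^ 2 ≤ 2 * m * s (φ r) / s (φ r) ^ 2 := by gcongr
      _ = 2 * m * (1 / s (φ r)) := by field_simp
      _ ≤ 2 * m * (1 / (r : ℝ) ^ 2) := by gcongr
  have hae := ae_tendsto_zero_of_summable_integral (μ := μ)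
    (f := fun r ω => g (φ r) ω ^ 2 / s (φ r) ^ 2)
    (fun r => ((hgm _).pow_const 2).div_const _) (fun r ω => by positivity)
    (fun r => (hgi _).div_const _) hsum
  filter_upwards [hae] with ω hω
  have hind0 : ∀ i, (0 : ℝ) ≤ (A i).indicator (1 : Ω → ℝ) ω := fun i =>
    Set.indicator_nonneg (fun _ _ => zero_le_one) _
  refine tendsto_div_of_tendsto_squares (φ := φ)
    (N := fun n => ∑ i ∈ Finset.range n, (A i).indicator (1 : Ω → ℝ) ω) (s := s) ?_ ?_ ?_ ?_ ?_ hφ hφ'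
    hdiv ?_
  · exact monotone_nat_of_le_succ fun n => by
      rw [Finset.sum_range_succ]; linarith [hind0 n]
  · exact monotone_nat_of_le_succ fun n => by
      simp only [hs]
      rw [Finset.sum_range_succ]; linarith [measureReal_nonneg (μ := μ) (s := A n)]
  · exact fun n => Finset.sum_nonneg fun i _ => hind0 i
  · simp [hs]
  · intro n
    simp only [hs]
    rw [Finset.sum_range_succ]
    linarith [measureReal_le_one (μ := μ) (s := A n)]
  · have h1 : Tendsto (fun r => g (φ r) ω / s (φ r)) atTop (𝓝 0) := by
      rw [tendsto_zero_iff_abs_tendsto_zero]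
      have h2 := hω.sqrt
      rw [Real.sqrt_zero] at h2
      refine h2.congr fun r => ?_
      rw [← div_pow, Real.sqrt_sq_eq_abs, Function.comp_apply]
    have h2 := h1.add_const 1
    rw [zero_add] at h2
    refine h2.congr' ?_
    filter_upwards [eventually_gt_atTop 0] with r hr
    have hr' : (0 : ℝ) < r := by exact_mod_cast hr
    have h3 : 0 < s (φ r) := lt_of_lt_of_le (by positivity) (hφ r)
    simp only [g, Finset.sum_sub_distrib]
    change (_ - s (φ r)) / s (φ r) + 1 = _
    field_simp
    ring

end Counting

/-! ### Existence of a generic sequence `w` by independent uniform choices -/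

noncomputable section

namespace CantorSeries

open MeasureTheory Asymptotics

theorem isLittleO_sum_sub_sum {f g R : ℕ → ℝ} (h : ∀ᶠ i in atTop, f i = g i)
    (hR : Tendsto R atTop atTop) :
    (fun n => ∑ i ∈ Finset.range n, f i - ∑ i ∈ Finset.range n, g i) =o[atTop] R := by
  obtain ⟨N, hN⟩ := eventually_atTop.1 h
  set C := ∑ i ∈ Finset.range N, (f i - g i) with hC
  have h1 : (fun _ : ℕ => C) =o[atTop] R :=
    isLittleO_const_left.2 (Or.inr (tendsto_norm_atTop_atTop.comp hR))
  refine h1.congr' ?_ EventuallyEq.rfl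
  filter_upwards [eventually_ge_atTop N] with n hn
  rw [← Finset.sum_sub_distrib, hC]
  refine Finset.sum_subset (Finset.range_mono hn) fun i _ hi => ?_
  rw [hN i (by simpa using hi), sub_self]

theorem infinitePi_real_pi_inter {ν : ℕ → Measure ℝ} [∀ i, IsProbabilityMeasure (ν i)]
    {s s' : Finset ℕ} (h : Disjoint s s') {t t' : ℕ → Set ℝ} (ht : ∀ i, MeasurableSet (t i))
    (ht' : ∀ i, MeasurableSet (t' i)) :
    (Measure.infinitePi ν).real (Set.pi s t ∩ Set.pi s' t') =
      (Measure.infinitePi ν).real (Set.pi s t) * (Measure.infinitePi ν).real (Set.pi s' t') := by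
  have e : Set.pi s t ∩ Set.pi s' t' =
      Set.pi (s ∪ s' : Finset ℕ) (fun k => if k ∈ s then t k else t' k) := by
    ext x
    simp only [Set.mem_inter_iff, Set.mem_pi, Finset.mem_coe, Finset.mem_union]
    constructor
    · rintro ⟨h1, h2⟩ i hi
      split_ifs with his
      · exact h1 i his
      · exact h2 i (hi.resolve_left his)
    · intro h1
      refine ⟨fun i hi => by simpa [hi] using h1 i (Or.inl hi), fun i hi => ?_⟩
      have := Finset.disjoint_right.1 h hi
      simpa [this] using h1 i (Or.inr hi)
  have hm : ∀ k, MeasurableSet (if k ∈ s then t k else t' k) := fun k => by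
    split_ifs
    exacts [ht k, ht' k]
  simp only [Measure.real]
  rw [← ENNReal.toReal_mul, e, Measure.infinitePi_pi _ fun i _ => hm i,
    Measure.infinitePi_pi _ fun i _ => ht i, Measure.infinitePi_pi _ fun i _ => ht' i,
    Finset.prod_union h]
  congr 2
  · exact Finset.prod_congr rfl fun i hi => by rw [if_pos hi]
  · exact Finset.prod_congr rfl fun i hi => by rw [if_neg (Finset.disjoint_right.1 h hi)]

/-- The uniform distribution on `[0, 1)`. -/
def unif : Measure ℝ := volume.restrict (Set.Ico 0 1)

instance : IsProbabilityMeasure unif := ⟨by simp [unif]⟩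

theorem unif_real_Ico {a b : ℝ} (ha : 0 ≤ a) (hab : a ≤ b) (hb : b ≤ 1) :
    unif.real (Set.Ico a b) = b - a := by
  rw [unif, measureReal_restrict_apply measurableSet_Ico,
    Set.inter_eq_left.2 (Set.Ico_subset_Ico ha hb), Real.volume_real_Ico_of_le hab]

theorem measurableSet_floor_eq (q : ℝ) (e : ℕ) : MeasurableSet {x : ℝ | ⌊q * x⌋₊ = e} :=
  (Nat.measurable_floor.comp (measurable_const_mul q)) (measurableSet_singleton e)

theorem unif_real_floor_eq {q e : ℕ} (he : e < q) :
    unif.real {x : ℝ | ⌊(q : ℝ) * x⌋₊ = e} = 1 / q := by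
  have hq : (0 : ℝ) < q := by exact_mod_cast (Nat.zero_le e).trans_lt he
  have he' : (e : ℝ) + 1 ≤ q := by exact_mod_cast he
  have e1 : {x : ℝ | ⌊(q : ℝ) * x⌋₊ = e} ∩ Set.Ico 0 1 =
      Set.Ico ((e : ℝ) / q) (((e : ℝ) + 1) / q) := by
    ext x
    simp only [Set.mem_inter_iff, Set.mem_ofPred_eq, Set.mem_Ico, div_le_iff₀' hq, lt_div_iff₀' hq]
    constructor
    · rintro ⟨h1, h2, -⟩
      exact (Nat.floor_eq_iff (by positivity)).1 h1
    · rintro ⟨h1, h2⟩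
      have h3 : 0 ≤ (q : ℝ) * x := (Nat.cast_nonneg e).trans h1
      have h4 : 0 ≤ x := nonneg_of_mul_nonneg_right h3 hq
      refine ⟨(Nat.floor_eq_iff h3).2 ⟨h1, h2⟩, h4, ?_⟩
      by_contra! h5
      nlinarith
  rw [unif, measureReal_restrict_apply (measurableSet_floor_eq _ _), e1,
    Real.volume_real_Ico_of_le (by gcongr; linarith)]
  field_simp
  ring

/-- The block `B` occurs at position `i` in the sequence of digits `d`. -/
def Occurs (d : ℕ → ℕ) {k : ℕ} (B : Fin k → ℕ) (i : ℕ) : Prop := ∀ t : Fin k, d (i + t) = B t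

/-- The digits `⌊q_{i+1} w_i⌋`. -/
def rawDigit (Q : ℕ → ℕ) (w : ℕ → ℝ) (i : ℕ) : ℕ := ⌊(Q i : ℝ) * w i⌋₊

open Classical in
/-- The truth value of a proposition, as a real number. -/
def ind (p : Prop) : ℝ := if p then 1 else 0

theorem ind_of {p : Prop} (h : p) : ind p = 1 := if_pos h

theorem ind_of_not {p : Prop} (h : ¬ p) : ind p = 0 := if_neg h

theorem ind_mono {p q : Prop} (h : p → q) : ind p ≤ ind q := by
  by_cases hp : p
  · rw [ind_of hp, ind_of (h hp)]
  · rw [ind_of_not hp]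
    by_cases hq : q
    · rw [ind_of hq]; exact zero_le_one
    · rw [ind_of_not hq]

theorem ind_nonneg (p : Prop) : 0 ≤ ind p := by
  rw [← ind_of_not (p := False) id]
  exact ind_mono False.elim

theorem ind_le_one (p : Prop) : ind p ≤ 1 := by
  rw [← ind_of trivial]
  exact ind_mono fun _ => trivial

/-- The number of `i < n` with `P i`. -/
def count (P : ℕ → Prop) (n : ℕ) : ℝ := ∑ i ∈ Finset.range n, ind (P i)

theorem count_eq_card (P : ℕ → Prop) [DecidablePred P] (n : ℕ) :
    count P n = ((Finset.range n).filter P).card := by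
  rw [Finset.natCast_card_filter, count]
  refine Finset.sum_congr rfl fun i _ => ?_
  by_cases h : P i
  · rw [ind_of h, if_pos h]
  · rw [ind_of_not h, if_neg h]

theorem count_nonneg (P : ℕ → Prop) (n : ℕ) : 0 ≤ count P n :=
  Finset.sum_nonneg fun _ _ => ind_nonneg _

/-- The side at position `j` of the box of all `w` for which the block `B` occurs at `i` among the
digits of `w`, followed by a term in `[a, b)`. -/
def boxSide (Q : ℕ → ℕ) {k : ℕ} (B : Fin k → ℕ) (a b : ℝ) (i j : ℕ) : Set ℝ :=
  if h : j - i < k then {x : ℝ | ⌊(Q j : ℝ) * x⌋₊ = B ⟨j - i, h⟩} else Set.Ico a b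

/-- The set of all `w` for which the block `B` occurs at `i` among the digits of `w`, followed by a
term in `[a, b)`. -/
def box (Q : ℕ → ℕ) {k : ℕ} (B : Fin k → ℕ) (a b : ℝ) (i : ℕ) : Set (ℕ → ℝ) :=
  Set.pi (Finset.Ico i (i + (k + 1)) : Finset ℕ) (boxSide Q B a b i)

theorem mem_box {Q : ℕ → ℕ} {k : ℕ} {B : Fin k → ℕ} {a b : ℝ} {i : ℕ} {w : ℕ → ℝ} :
    w ∈ box Q B a b i ↔ Occurs (rawDigit Q w) B i ∧ w (i + k) ∈ Set.Ico a b := by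
  simp only [box, Set.mem_pi, Finset.mem_coe, Finset.mem_Ico, Occurs, rawDigit]
  constructor
  · intro h
    refine ⟨fun t => ?_, ?_⟩
    · have := h (i + t) ⟨by omega, by omega⟩
      have h1 : i + (t : ℕ) - i < k := by omega
      rw [boxSide, dif_pos h1] at this
      simpa using this
    · have := h (i + k) ⟨by omega, by omega⟩
      rwa [boxSide, dif_neg (by omega)] at this
  · rintro ⟨h1, h2⟩ j ⟨hj1, hj2⟩
    rw [boxSide]
    split_ifs with h3
    · have := h1 ⟨j - i, h3⟩
      simpa [Nat.add_sub_cancel' hj1] using this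
    · have : j = i + k := by omega
      exact this ▸ h2

theorem measurableSet_boxSide (Q : ℕ → ℕ) {k : ℕ} (B : Fin k → ℕ) (a b : ℝ) (i j : ℕ) :
    MeasurableSet (boxSide Q B a b i j) := by
  rw [boxSide]
  split_ifs
  exacts [measurableSet_floor_eq _ _, measurableSet_Ico]

theorem measurableSet_box (Q : ℕ → ℕ) {k : ℕ} (B : Fin k → ℕ) (a b : ℝ) (i : ℕ) :
    MeasurableSet (box Q B a b i) :=
  MeasurableSet.pi (Finset.countable_toSet _) fun _ _ => measurableSet_boxSide _ _ _ _ _ _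

theorem infinitePi_real_box {Q : ℕ → ℕ} {k : ℕ} {B : Fin k → ℕ} {a b : ℝ} {i : ℕ}
    (h : ∀ t : Fin k, B t < Q (i + t)) (ha : 0 ≤ a) (hab : a ≤ b) (hb : b ≤ 1) :
    (Measure.infinitePi fun _ : ℕ => unif).real (box Q B a b i) =
      (b - a) * (1 / ∏ t : Fin k, (Q (i + t) : ℝ)) := by
  rw [Measure.real, box, Measure.infinitePi_pi _ fun _ _ => measurableSet_boxSide _ _ _ _ _ _,
    ENNReal.toReal_prod, Finset.prod_Ico_eq_prod_range, Nat.add_sub_cancel_left,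
    Finset.prod_range_succ, Finset.prod_range, mul_comm]
  congr 1
  · rw [boxSide, dif_neg (by omega)]
    exact unif_real_Ico ha hab hb
  · rw [one_div, ← Finset.prod_inv_distrib]
    refine Finset.prod_congr rfl fun t _ => ?_
    have h1 : i + (t : ℕ) - i < k := by omega
    rw [boxSide, dif_pos h1, ← one_div]
    have h2 : (⟨i + (t : ℕ) - i, h1⟩ : Fin k) = t := by ext; simp
    rw [h2]
    exact unif_real_floor_eq (h t)

theorem eventually_lt_of_infiniteInLimit {Q : ℕ → ℕ} (hlim : InfiniteInLimit Q) {k : ℕ}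
    (B : Fin k → ℕ) : ∀ᶠ i in atTop, ∀ t : Fin k, B t < Q (i + t) :=
  eventually_all.2 fun t => (hlim.comp (tendsto_add_atTop_nat t)).eventually_gt_atTop _

/-- Boxes with starting positions at least `k + 1` apart involve disjoint sets of coordinates and
are independent, so `ae_tendsto_count_div` applies. Since `Q` is infinite in limit, the block is
admissible from some position on, and there the probability of the box is `(b - a)` times that of
the block. -/
theorem ae_isLittleO_count_sub {Q : ℕ → ℕ} (hlim : InfiniteInLimit Q) {k : ℕ}
    (hk : KDivergent Q k) (B : Fin k → ℕ) {a b : ℝ} (ha : 0 ≤ a) (hab : a < b) (hb : b ≤ 1) :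
    ∀ᵐ w ∂(Measure.infinitePi fun _ : ℕ => unif),
      (fun n => count (fun i => Occurs (rawDigit Q w) B i ∧ w (i + k) ∈ Set.Ico a b) n -
        (b - a) * divergenceSum Q k n) =o[atTop] fun n => divergenceSum Q k n := by
  set μ := Measure.infinitePi fun _ : ℕ => unif
  set s : ℕ → ℝ := fun n => ∑ i ∈ Finset.range n, μ.real (box Q B a b i) with hs
  have h1 : (fun n => s n - (b - a) * divergenceSum Q k n) =o[atTop] fun n => divergenceSum Q k n := by
    simp only [hs, divergenceSum, Finset.mul_sum]
    refine isLittleO_sum_sub_sum ?_ hk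
    filter_upwards [eventually_lt_of_infiniteInLimit hlim B] with i hi
    exact infinitePi_real_box hi ha hab.le hb
  have h2 : s ~[atTop] fun n => (b - a) * divergenceSum Q k n :=
    h1.trans_isBigO (isBigO_self_const_mul (sub_ne_zero.2 hab.ne') _ _)
  have h3 : Tendsto s atTop atTop :=
    h2.symm.tendsto_atTop (hk.const_mul_atTop (sub_pos.2 hab))
  filter_upwards [ae_tendsto_count_div (μ := μ) (A := box Q B a b)
    (fun i => measurableSet_box _ _ _ _ _) (m := k + 1) (fun i j hij => infinitePi_real_pi_inter
      (Finset.Ico_disjoint_Ico_consecutive _ _ _ |>.mono_right (Finset.Ico_subset_Ico_left hij))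
      (measurableSet_boxSide _ _ _ _ _) (measurableSet_boxSide _ _ _ _ _)) h3] with w hw
  have h4 : (fun n => count (fun i => Occurs (rawDigit Q w) B i ∧ w (i + k) ∈ Set.Ico a b) n - s n)
      =o[atTop] s := by
    refine (isEquivalent_iff_tendsto_one ?_).2 (hw.congr fun n => ?_)
    · filter_upwards [h3.eventually_gt_atTop 0] with n hn using hn.ne'
    · rw [Pi.div_apply, count]
      congr 1
      refine Finset.sum_congr rfl fun i _ => ?_
      by_cases h : w ∈ box Q B a b i
      · rw [Set.indicator_of_mem h, ind_of (mem_box.1 h), Pi.one_apply]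
      · rw [Set.indicator_of_notMem h, ind_of_not fun h' => h (mem_box.2 h')]
  have h5 : s =O[atTop] fun n => divergenceSum Q k n :=
    h2.isBigO.trans (isBigO_const_mul_self _ _ _)
  exact ((h4.trans_isBigO h5).add h1).congr_left fun n => by ring

/-- The sequence `w` in `[0, 1)` behaves like a random one with respect to the frequencies of all
blocks of digits followed by a term in a prescribed interval. -/
structure IsGeneric (Q : ℕ → ℕ) (w : ℕ → ℝ) : Prop where
  mem_Ico : ∀ i, w i ∈ Set.Ico (0 : ℝ) 1
  isLittleO : ∀ k, KDivergent Q k → ∀ B : Fin k → ℕ, ∀ a b : ℚ, 0 ≤ a → a < b → b ≤ 1 →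
    (fun n => count (fun i => Occurs (rawDigit Q w) B i ∧ w (i + k) ∈ Set.Ico (a : ℝ) b) n -
      ((b : ℝ) - a) * divergenceSum Q k n) =o[atTop] fun n => divergenceSum Q k n

/-- With rational endpoints there are only countably many conditions, each of which holds almost
surely. -/
theorem exists_isGeneric {Q : ℕ → ℕ} (hlim : InfiniteInLimit Q) : ∃ w, IsGeneric Q w := by
  have h1 : ∀ᵐ w ∂(Measure.infinitePi fun _ : ℕ => unif), ∀ i, w i ∈ Set.Ico (0 : ℝ) 1 := by
    refine ae_all_iff.2 fun i => ?_
    have : ∀ᵐ x ∂unif, x ∈ Set.Ico (0 : ℝ) 1 := ae_restrict_mem measurableSet_Ico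
    exact (measurePreserving_eval_infinitePi (fun _ : ℕ => unif) i).quasiMeasurePreserving.ae this
  have h2 : ∀ᵐ w ∂(Measure.infinitePi fun _ : ℕ => unif),
      ∀ k, KDivergent Q k → ∀ B : Fin k → ℕ, ∀ a b : ℚ, 0 ≤ a → a < b → b ≤ 1 →
      (fun n => count (fun i => Occurs (rawDigit Q w) B i ∧ w (i + k) ∈ Set.Ico (a : ℝ) b) n -
        ((b : ℝ) - a) * divergenceSum Q k n) =o[atTop] fun n => divergenceSum Q k n := by
    refine ae_all_iff.2 fun k => ae_all_iff.2 fun hk => ae_all_iff.2 fun B => ae_all_iff.2 fun a =>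
      ae_all_iff.2 fun b => ae_all_iff.2 fun ha => ae_all_iff.2 fun hab => ae_all_iff.2 fun hb => ?_
    exact ae_isLittleO_count_sub hlim hk B (by exact_mod_cast ha) (by exact_mod_cast hab)
      (by exact_mod_cast hb)
  obtain ⟨w, h⟩ := (h1.and h2).exists
  exact ⟨w, h.1, h.2⟩

end CantorSeries

end

noncomputable section

namespace CantorSeries

open Asymptotics

/-! ### Windows, and modifications whose frequency varies from window to window -/

section Windows

variable {Q : ℕ → ℕ}

/-- The probability `1 / (q_i ⋯ q_{i+k-1})` of a block of length `k`. -/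
def blockProb (Q : ℕ → ℕ) (k i : ℕ) : ℝ := 1 / ∏ t : Fin k, (Q (i + t) : ℝ)

theorem blockProb_nonneg (Q : ℕ → ℕ) (k i : ℕ) : 0 ≤ blockProb Q k i := by
  unfold blockProb; positivity

theorem blockProb_le_one (hQ : IsBasicSequence Q) (k i : ℕ) : blockProb Q k i ≤ 1 := by
  have h : (1 : ℝ) ≤ ∏ t : Fin k, (Q (i + t) : ℝ) := Finset.one_le_prod fun t _ => by
    have := hQ (i + t)
    exact_mod_cast (by omega : 1 ≤ Q (i + t))
  exact (div_le_one (by linarith)).2 h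

theorem divergenceSum_eq (Q : ℕ → ℕ) (k n : ℕ) :
    divergenceSum Q k n = ∑ i ∈ Finset.range n, blockProb Q k i := rfl

theorem divergenceSum_mono (Q : ℕ → ℕ) (k : ℕ) : Monotone (divergenceSum Q k) :=
  monotone_nat_of_le_succ fun n => by
    rw [divergenceSum_eq, divergenceSum_eq, Finset.sum_range_succ]
    linarith [blockProb_nonneg Q k n]

theorem divergenceSum_nonneg (Q : ℕ → ℕ) (k n : ℕ) : 0 ≤ divergenceSum Q k n :=
  Finset.sum_nonneg fun i _ => blockProb_nonneg Q k i

theorem divergenceSum_add_le (hQ : IsBasicSequence Q) (k n m : ℕ) :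
    divergenceSum Q k (n + m) ≤ divergenceSum Q k n + m := by
  induction m with
  | zero => simp
  | succ m ih =>
    rw [← add_assoc, divergenceSum_eq, Finset.sum_range_succ, ← divergenceSum_eq]
    push_cast
    linarith [blockProb_le_one hQ k (n + m)]

theorem divergenceSum_le (hQ : IsBasicSequence Q) (k n : ℕ) : divergenceSum Q k n ≤ n := by
  simpa [divergenceSum] using divergenceSum_add_le hQ k 0 n

/-- The breakpoints `W` divide the positions into windows so long that the part before a window
is negligible at the end of the window. -/
structure IsWindowSequence (Q W : ℕ → ℕ) : Prop where
  strictMono : StrictMono W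
  zero : W 0 = 0
  growth : ∀ m k : ℕ, k ≤ m + 1 → KDivergent Q k →
    ((m : ℝ) + 1) * W m ≤ divergenceSum Q k (W (m + 1))

theorem exists_isWindowSequence (Q : ℕ → ℕ) : ∃ W, IsWindowSequence Q W := by
  have h : ∀ m a : ℕ, ∃ b, a < b ∧ ∀ k ∈ Finset.range (m + 2), KDivergent Q k →
      ((m : ℝ) + 1) * a ≤ divergenceSum Q k b := by
    intro m a
    refine ((eventually_gt_atTop a).and ((Finset.eventually_all _).2 fun k _ => ?_)).exists
    by_cases hk : KDivergent Q k
    · filter_upwards [hk.eventually_ge_atTop (((m : ℝ) + 1) * a)] with n hn _ using hn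
    · exact Eventually.of_forall fun n h => absurd h hk
  choose b hb1 hb2 using h
  let W : ℕ → ℕ := fun m => Nat.rec 0 (fun m a => b m a) m
  exact ⟨W, strictMono_nat_of_lt_succ fun m => hb1 m (W m), rfl, fun m k hk hd =>
    hb2 m (W m) k (Finset.mem_range.2 (by omega)) hd⟩

/-- The index of the window to which a position belongs. -/
def windowIndex (W : ℕ → ℕ) (n : ℕ) : ℕ := Nat.findGreatest (fun m => W m ≤ n) n

variable {W : ℕ → ℕ}

theorem IsWindowSequence.le_windowIndex_iff (hW : IsWindowSequence Q W) {m n : ℕ} :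
    m ≤ windowIndex W n ↔ W m ≤ n := by
  constructor
  · intro h
    have h0 : W (windowIndex W n) ≤ n :=
      Nat.findGreatest_spec (P := fun m => W m ≤ n) (Nat.zero_le n) (by simp [hW.zero])
    exact (hW.strictMono.monotone h).trans h0
  · intro h
    exact Nat.le_findGreatest ((hW.strictMono.le_apply).trans h) h

theorem IsWindowSequence.windowIndex_eq (hW : IsWindowSequence Q W) {m n : ℕ} (h1 : W m ≤ n)
    (h2 : n < W (m + 1)) : windowIndex W n = m := by
  refine le_antisymm ?_ (hW.le_windowIndex_iff.2 h1)
  by_contra! h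
  exact absurd (hW.le_windowIndex_iff.1 (Nat.succ_le_of_lt h)) (not_le.2 h2)

theorem IsWindowSequence.tendsto_windowIndex (hW : IsWindowSequence Q W) :
    Tendsto (windowIndex W) atTop atTop :=
  tendsto_atTop.2 fun m => by
    filter_upwards [eventually_ge_atTop (W m)] with n hn using hW.le_windowIndex_iff.2 hn

/-- All windows except the current one and its predecessor are negligible: if `n + k` lies in window
`m + 1`, growth gives `(m + 1) * W m ≤ divergenceSum Q k (n + k)`, which is at most twice the sum up
to `n` once that sum exceeds `k`. -/
theorem IsWindowSequence.eventually_prev_le (hQ : IsBasicSequence Q) (hW : IsWindowSequence Q W)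
    {k : ℕ} (hk : KDivergent Q k) {ε : ℝ} (hε : 0 < ε) :
    ∀ᶠ n in atTop, (W (windowIndex W (n + k) - 1) : ℝ) ≤ ε * divergenceSum Q k n := by
  have h1 : Tendsto (fun n => windowIndex W (n + k)) atTop atTop :=
    hW.tendsto_windowIndex.comp (tendsto_add_atTop_nat k)
  have h2 : Tendsto (fun n => ((windowIndex W (n + k) : ℕ) : ℝ)) atTop atTop :=
    tendsto_natCast_atTop_atTop.comp h1
  filter_upwards [h1.eventually_ge_atTop (k + 1), h2.eventually_ge_atTop (2 / ε),
    hk.eventually_ge_atTop (k : ℝ)] with n hn1 hn2 hn3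
  obtain ⟨m, hm⟩ : ∃ m, windowIndex W (n + k) = m + 1 :=
    ⟨windowIndex W (n + k) - 1, by omega⟩
  rw [hm] at hn1 hn2 ⊢
  have h3 := hW.growth m k (by omega) hk
  have h4 : W (m + 1) ≤ n + k := hW.le_windowIndex_iff.1 hm.ge
  have h5 := divergenceSum_mono Q k h4
  have h6 := divergenceSum_add_le hQ k n k
  rw [div_le_iff₀ hε] at hn2
  push_cast at hn2
  simp only [Nat.add_sub_cancel]
  have h7 : (0 : ℝ) ≤ W m := Nat.cast_nonneg _
  nlinarith

theorem eventually_forall_le_of_isLittleO {G R : ℕ → ℝ} (h : G =o[atTop] R) (hR : Monotone R)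
    (hR0 : ∀ n, 0 ≤ R n) (htop : Tendsto R atTop atTop) {ε : ℝ} (hε : 0 < ε) :
    ∀ᶠ n in atTop, ∀ j ≤ n, |G j| ≤ ε * R n := by
  obtain ⟨N, hN⟩ := eventually_atTop.1 (isLittleO_iff.1 h hε)
  filter_upwards [(htop.const_mul_atTop hε).eventually_ge_atTop
    (∑ j ∈ Finset.range N, |G j|)] with n hn j hj
  rcases le_or_gt N j with h1 | h1
  · refine (hN j h1).trans ?_
    rw [Real.norm_of_nonneg (hR0 j)]
    exact mul_le_mul_of_nonneg_left (hR hj) hε.le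
  · exact (Finset.single_le_sum (f := fun j => |G j|) (fun _ _ => abs_nonneg _)
      (Finset.mem_range.2 h1)).trans hn

/-- Switching between finitely many families `g r` at the window boundaries costs nothing. The early
windows are bounded trivially by their length, and on the last two windows the sum consists of
differences of partial sums of single families. This makes five terms, each at most `ε / 5`. -/
theorem isLittleO_sum_window_of_bounded (hQ : IsBasicSequence Q) (hW : IsWindowSequence Q W)
    {k : ℕ} (hk : KDivergent Q k) {g : ℕ → ℕ → ℝ} (hg1 : ∀ r i, |g r i| ≤ 1)
    (hg : ∀ r, (fun n => ∑ i ∈ Finset.range n, g r i) =o[atTop] fun n => divergenceSum Q k n)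
    {u : ℕ → ℕ} {K : ℕ} (hu : ∀ m, u m ≤ K) :
    (fun n => ∑ i ∈ Finset.range n, g (u (windowIndex W (i + k))) i) =o[atTop]
      fun n => divergenceSum Q k n := by
  refine isLittleO_iff.2 fun ε hε => ?_
  have hε5 : 0 < ε / 5 := by positivity
  have h1 : ∀ᶠ n in atTop, ∀ r ∈ Finset.range (K + 1), ∀ j ≤ n,
      |∑ i ∈ Finset.range j, g r i| ≤ ε / 5 * divergenceSum Q k n :=
    (Finset.eventually_all _).2 fun r _ => eventually_forall_le_of_isLittleO (hg r)
      (divergenceSum_mono Q k) (divergenceSum_nonneg Q k) hk hε5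
  have h2 : Tendsto (fun n => windowIndex W (n + k)) atTop atTop :=
    hW.tendsto_windowIndex.comp (tendsto_add_atTop_nat k)
  filter_upwards [h1, hW.eventually_prev_le hQ hk hε5, h2.eventually_ge_atTop 1] with n hn1 hn2 hn3
  obtain ⟨m, hm⟩ : ∃ m, windowIndex W (n + k) = m + 1 :=
    ⟨windowIndex W (n + k) - 1, by omega⟩
  rw [hm, Nat.add_sub_cancel] at hn2
  have hWm : W m < W (m + 1) := hW.strictMono (Nat.lt_succ_self m)
  have hWn : W (m + 1) ≤ n + k := hW.le_windowIndex_iff.1 hm.ge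
  have hWn' : n + k < W (m + 1 + 1) := by
    by_contra! h
    have := hW.le_windowIndex_iff.2 h
    omega
  -- The window that matters for a block starting at `i` is that of the following term `i + k`, so
  -- the boundaries shift by `k`.
  set a := W m - k
  set b := W (m + 1) - k
  have hab : a ≤ b := Nat.sub_le_sub_right hWm.le k
  have hbn : b ≤ n := by omega
  have hr : ∀ m', u m' ∈ Finset.range (K + 1) := fun m' =>
    Finset.mem_range.2 (Nat.lt_succ_of_le (hu m'))
  rw [Real.norm_of_nonneg (divergenceSum_nonneg Q k n), Real.norm_eq_abs,
    ← Finset.sum_range_add_sum_Ico _ hbn, ← Finset.sum_range_add_sum_Ico _ hab]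
  have e1 : ∑ i ∈ Finset.Ico a b, g (u (windowIndex W (i + k))) i =
      ∑ i ∈ Finset.range b, g (u m) i - ∑ i ∈ Finset.range a, g (u m) i := by
    rw [← Finset.sum_Ico_eq_sub _ hab]
    refine Finset.sum_congr rfl fun i hi => ?_
    rw [Finset.mem_Ico] at hi
    rw [hW.windowIndex_eq (m := m) (by omega) (by omega)]
  have e2 : ∑ i ∈ Finset.Ico b n, g (u (windowIndex W (i + k))) i =
      ∑ i ∈ Finset.range n, g (u (m + 1)) i - ∑ i ∈ Finset.range b, g (u (m + 1)) i := by
    rw [← Finset.sum_Ico_eq_sub _ hbn]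
    refine Finset.sum_congr rfl fun i hi => ?_
    rw [Finset.mem_Ico] at hi
    rw [hW.windowIndex_eq (m := m + 1) (by omega) (by omega)]
  have h3 : |∑ i ∈ Finset.range a, g (u (windowIndex W (i + k))) i| ≤
      ε / 5 * divergenceSum Q k n := by
    refine (Finset.abs_sum_le_sum_abs _ _).trans ?_
    refine (Finset.sum_le_sum fun i _ => hg1 _ i).trans ?_
    rw [Finset.sum_const, Finset.card_range, nsmul_eq_mul, mul_one]
    exact le_trans (by exact_mod_cast Nat.sub_le _ _) hn2
  rw [e1, e2]
  have h4 := hn1 _ (hr m) b hbn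
  have h5 := hn1 _ (hr m) a (hab.trans hbn)
  have h6 := hn1 _ (hr (m + 1)) n le_rfl
  have h7 := hn1 _ (hr (m + 1)) b hbn
  rw [abs_le] at *
  constructor <;> linarith [h3.1, h3.2, h4.1, h4.2, h5.1, h5.2, h6.1, h6.2, h7.1, h7.2]

/-- The interval of length `1 / (r + 4)` that ends at `c`. -/
def tailInterval (c : ℝ) (r : ℕ) : Set ℝ := Set.Ico (c - 1 / ((r : ℝ) + 4)) c

theorem tailInterval_antitone (c : ℝ) : Antitone (tailInterval c) := fun r s h => by
  refine Set.Ico_subset_Ico_left ?_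
  have : (1 : ℝ) / (s + 4) ≤ 1 / (r + 4) := by gcongr
  linarith

/-- The expected number of `i < n` at which a given block of length `k` occurs and is followed by
a term in `tailInterval c (u m)`, where `m` is the index of the window to which the term belongs. -/
def expectedHits (Q W : ℕ → ℕ) (k : ℕ) (u : ℕ → ℕ) (n : ℕ) : ℝ :=
  ∑ i ∈ Finset.range n, blockProb Q k i * (1 / ((u (windowIndex W (i + k)) : ℝ) + 4))

/-- For unbounded `u`, infinitely many interval lengths occur and the finite case does not apply
directly. Truncating `u` at a large `K` alters only terms inside the interval of length `1 / (K +
4)`, whose total contribution is a small multiple of the divergence sum. -/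
theorem isLittleO_count_sub_expectedHits (hQ : IsBasicSequence Q) (hW : IsWindowSequence Q W)
    {k : ℕ} (hk : KDivergent Q k) {P : ℕ → Prop} {w : ℕ → ℝ} {c : ℝ}
    (h : ∀ r : ℕ, (fun n => count (fun i => P i ∧ w (i + k) ∈ tailInterval c r) n -
      1 / ((r : ℝ) + 4) * divergenceSum Q k n) =o[atTop] fun n => divergenceSum Q k n)
    (u : ℕ → ℕ) :
    (fun n => count (fun i => P i ∧ w (i + k) ∈ tailInterval c (u (windowIndex W (i + k)))) n -
      expectedHits Q W k u n) =o[atTop] fun n => divergenceSum Q k n := by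
  let f : ℕ → ℕ → ℝ := fun r i => ind (P i ∧ w (i + k) ∈ tailInterval c r)
  let p : ℕ → ℕ → ℝ := fun r i => blockProb Q k i * (1 / ((r : ℝ) + 4))
  have hf0 : ∀ r i, 0 ≤ f r i := fun r i => ind_nonneg _
  have hf1 : ∀ r i, f r i ≤ 1 := fun r i => ind_le_one _
  have hfa : ∀ r s i, r ≤ s → f s i ≤ f r i := fun r s i hrs =>
    ind_mono fun h1 => ⟨h1.1, tailInterval_antitone c hrs h1.2⟩
  have hp0 : ∀ r i, 0 ≤ p r i := fun r i => mul_nonneg (blockProb_nonneg Q k i) (by positivity)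
  have hp1 : ∀ r i, p r i ≤ 1 := fun r i =>
    mul_le_one₀ (blockProb_le_one hQ k i) (by positivity) <| by
      rw [div_le_one (by positivity)]; linarith [(Nat.cast_nonneg r : (0 : ℝ) ≤ r)]
  have hpa : ∀ r s i, r ≤ s → p s i ≤ p r i := fun r s i hrs =>
    mul_le_mul_of_nonneg_left (by gcongr) (blockProb_nonneg Q k i)
  have hsum : ∀ r n, ∑ i ∈ Finset.range n, (f r i - p r i) =
      count (fun i => P i ∧ w (i + k) ∈ tailInterval c r) n -
        1 / ((r : ℝ) + 4) * divergenceSum Q k n := fun r n => by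
    rw [Finset.sum_sub_distrib, ← Finset.sum_mul, ← divergenceSum_eq, mul_comm]
    simp only [f, count]
  have hg : ∀ r, (fun n => ∑ i ∈ Finset.range n, (f r i - p r i)) =o[atTop]
      fun n => divergenceSum Q k n := fun r => by simpa only [hsum] using h r
  refine isLittleO_iff.2 fun ε hε => ?_
  obtain ⟨K, hK⟩ := exists_nat_gt (8 / ε)
  have hKε : 1 / ((K : ℝ) + 4) ≤ ε / 8 := by
    rw [div_lt_iff₀ hε] at hK
    rw [div_le_div_iff₀ (by positivity) (by norm_num)]
    nlinarith
  have h1 := isLittleO_sum_window_of_bounded hQ hW hk (g := fun r i => f r i - p r i)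
    (fun r i => abs_sub_le_iff.2 ⟨by linarith [hf1 r i, hp0 r i], by linarith [hp1 r i, hf0 r i]⟩) hg
    (u := fun m => min (u m) K) (K := K) fun m => min_le_right _ _
  filter_upwards [isLittleO_iff.1 h1 (half_pos hε), isLittleO_iff.1 (hg K) (show 0 < ε / 8 by positivity)]
    with n hn1 hn2
  rw [Real.norm_of_nonneg (divergenceSum_nonneg Q k n), Real.norm_eq_abs] at *
  -- Both `f` and `p` decrease in the index, so for `m ≥ K` all four terms lie between `0` and their
  -- values at `K`.
  have h2 : ∀ i m, |(f m i - p m i) - (f (min m K) i - p (min m K) i)| ≤ f K i + p K i := by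
    intro i m
    rcases le_total m K with hm | hm
    · rw [min_eq_left hm, sub_self, abs_zero]
      linarith [hf0 K i, hp0 K i]
    · rw [min_eq_right hm, abs_le]
      constructor <;> linarith [hfa K m i hm, hpa K m i hm, hf0 m i, hp0 m i]
  have h3 : |∑ i ∈ Finset.range n, ((f (u (windowIndex W (i + k))) i - p (u (windowIndex W (i + k))) i)
      - (f (min (u (windowIndex W (i + k))) K) i - p (min (u (windowIndex W (i + k))) K) i))| ≤
      ∑ i ∈ Finset.range n, (f K i - p K i) + 2 * (1 / ((K : ℝ) + 4) * divergenceSum Q k n) := by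
    refine (Finset.abs_sum_le_sum_abs _ _).trans ((Finset.sum_le_sum fun i _ => h2 i _).trans ?_)
    rw [Finset.sum_add_distrib, Finset.sum_sub_distrib]
    have : ∑ i ∈ Finset.range n, p K i = 1 / ((K : ℝ) + 4) * divergenceSum Q k n := by
      rw [divergenceSum_eq, mul_comm, Finset.sum_mul]
    linarith
  have h4 : 1 / ((K : ℝ) + 4) * divergenceSum Q k n ≤ ε / 8 * divergenceSum Q k n :=
    mul_le_mul_of_nonneg_right hKε (divergenceSum_nonneg Q k n)
  have h5 : count (fun i => P i ∧ w (i + k) ∈ tailInterval c (u (windowIndex W (i + k)))) n -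
      expectedHits Q W k u n = ∑ i ∈ Finset.range n,
        (f (u (windowIndex W (i + k))) i - p (u (windowIndex W (i + k))) i) := by
    rw [Finset.sum_sub_distrib]
    simp only [f, p, count, expectedHits]
  rw [h5]
  rw [Finset.sum_sub_distrib] at h3
  rw [abs_le] at *
  have h6 := divergenceSum_nonneg Q k n
  constructor <;> nlinarith [h3.1, h3.2, hn1.1, hn1.2, hn2.1, hn2.2]

theorem expectedHits_nonneg (Q W : ℕ → ℕ) (k : ℕ) (u : ℕ → ℕ) (n : ℕ) :
    0 ≤ expectedHits Q W k u n :=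
  Finset.sum_nonneg fun i _ => mul_nonneg (blockProb_nonneg Q k i) (by positivity)

theorem expectedHits_le (Q W : ℕ → ℕ) (k : ℕ) (u : ℕ → ℕ) (n : ℕ) :
    expectedHits Q W k u n ≤ 1 / 4 * divergenceSum Q k n := by
  rw [divergenceSum_eq, Finset.mul_sum]
  refine Finset.sum_le_sum fun i _ => ?_
  rw [mul_comm]
  refine mul_le_mul_of_nonneg_right ?_ (blockProb_nonneg Q k i)
  gcongr
  linarith [(Nat.cast_nonneg (u (windowIndex W (i + k))) : (0 : ℝ) ≤ _)]

/-- If `u m ≤ r` for infinitely many `m`, then at the end of such a window, which carries almost the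
whole divergence sum, a proportion of nearly `1 / (r + 4)` is hit. If `u` tends to infinity, the
weights tend to `0`. -/
theorem expectedHits_isLittleO_iff (hQ : IsBasicSequence Q) (hW : IsWindowSequence Q W)
    {k : ℕ} (hk : KDivergent Q k) (u : ℕ → ℕ) :
    (expectedHits Q W k u =o[atTop] fun n => divergenceSum Q k n) ↔ Tendsto u atTop atTop := by
  constructor
  · intro h
    by_contra hu
    obtain ⟨r, hr⟩ := not_forall.1 (mt tendsto_atTop.2 hu)
    have hr : ∃ᶠ m in atTop, u m ≤ r := (not_eventually.1 hr).mono fun m hm => (not_le.1 hm).le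
    set l : ℝ := 1 / ((r : ℝ) + 4)
    have hl : 0 < l := by positivity
    -- At `n = W (m + 1) - k` the starting positions whose following term lies in window `m` or
    -- earlier have just been exhausted.
    have hend : Tendsto (fun m => W (m + 1) - k) atTop atTop :=
      (tendsto_sub_atTop_nat k).comp (hW.strictMono.tendsto_atTop.comp (tendsto_add_atTop_nat 1))
    have hev := hend.eventually ((isLittleO_iff.1 h (show 0 < l / 4 by positivity)).and
      ((hW.eventually_prev_le hQ hk (show (0 : ℝ) < 1 / 2 by norm_num)).and
        ((hk.eventually_gt_atTop 0).and (eventually_gt_atTop 0))))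
    obtain ⟨m, hm, h1, h2, h3, h4⟩ := (hr.and_eventually hev).exists
    set n := W (m + 1) - k with hn
    have hnk : n + k = W (m + 1) := by omega
    rw [hnk, hW.windowIndex_eq le_rfl (hW.strictMono (Nat.lt_succ_self _)), Nat.add_sub_cancel] at h2
    rw [Real.norm_of_nonneg (expectedHits_nonneg _ _ _ _ _),
      Real.norm_of_nonneg (divergenceSum_nonneg _ _ _)] at h1
    have hWn : W m ≤ n ∨ n < W m := le_or_gt _ _
    have h5 : l * (divergenceSum Q k n - W m) ≤ expectedHits Q W k u n := by
      rcases hWn with hWn | hWn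
      · have h6 : l * ∑ i ∈ Finset.Ico (W m) n, blockProb Q k i ≤ expectedHits Q W k u n := by
          rw [Finset.mul_sum, expectedHits, ← Finset.sum_range_add_sum_Ico _ hWn]
          refine le_add_of_nonneg_of_le (expectedHits_nonneg Q W k u _) ?_
          refine Finset.sum_le_sum fun i hi => ?_
          rw [Finset.mem_Ico] at hi
          rw [hW.windowIndex_eq (m := m) (by omega) (by omega), mul_comm]
          refine mul_le_mul_of_nonneg_left ?_ (blockProb_nonneg Q k i)
          have : (u m : ℝ) ≤ r := by exact_mod_cast hm
          simp only [l]
          gcongr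
        rw [Finset.sum_Ico_eq_sub _ hWn, ← divergenceSum_eq, ← divergenceSum_eq] at h6
        have h7 := divergenceSum_le hQ k (W m)
        nlinarith
      · have h7 := divergenceSum_le hQ k n
        have h8 : (n : ℝ) ≤ W m := by exact_mod_cast hWn.le
        nlinarith [expectedHits_nonneg Q W k u n]
    nlinarith
  · intro hu
    have h1 : Tendsto (fun i => 1 / ((u (windowIndex W (i + k)) : ℝ) + 4)) atTop (𝓝 0) :=
      tendsto_const_nhds.div_atTop (tendsto_atTop_add_const_right _ _
        (tendsto_natCast_atTop_atTop.comp (hu.comp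
          (hW.tendsto_windowIndex.comp (tendsto_add_atTop_nat k)))))
    have h2 : (fun i => blockProb Q k i * (1 / ((u (windowIndex W (i + k)) : ℝ) + 4))) =o[atTop]
        blockProb Q k := by
      simpa using (isBigO_refl (blockProb Q k) atTop).mul_isLittleO ((isLittleO_one_iff ℝ).2 h1)
    exact h2.sum_range (blockProb_nonneg Q k) hk

end Windows

end CantorSeries

end

noncomputable section

namespace CantorSeries

open Asymptotics

/-! ### Real numbers with prescribed digits -/

section Realize

variable {Q : ℕ → ℕ}

/-- The number with integer part `0` and digits `d`. -/
def realize (Q : ℕ → ℕ) (d : ℕ → ℕ) : ℝ := ∑' i, (d i : ℝ) / partialProd Q (i + 1)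

theorem digit_term_le (hQ : IsBasicSequence Q) {e i : ℕ} (h : e < Q i) :
    (e : ℝ) / partialProd Q (i + 1) ≤ 1 / partialProd Q i - 1 / partialProd Q (i + 1) := by
  have hp := partialProd_pos hQ i
  have hq : (0 : ℝ) < Q i := by exact_mod_cast (Nat.zero_le e).trans_lt h
  have h' : (e : ℝ) + 1 ≤ Q i := by exact_mod_cast h
  have e1 : (1 : ℝ) / partialProd Q i - 1 / partialProd Q (i + 1)
      = ((Q i : ℝ) - 1) / partialProd Q (i + 1) := by
    rw [partialProd_succ]; push_cast; field_simp
  rw [e1]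
  exact div_le_div_of_nonneg_right (by linarith) (partialProd_pos hQ _).le

theorem norm_digit_term_le (hQ : IsBasicSequence Q) {e i : ℕ} (h : e < Q i) :
    ‖(e : ℝ) / partialProd Q (i + 1)‖ ≤ (1 / 2 : ℝ) ^ i := by
  have h1 := digit_term_le hQ h
  have h2 := one_div_pos.2 (partialProd_pos hQ (i + 1))
  have h3 : (1 : ℝ) / partialProd Q i ≤ (1 / 2 : ℝ) ^ i := by
    rw [one_div_pow]
    apply one_div_le_one_div_of_le (by positivity)
    exact_mod_cast two_pow_le_partialProd hQ i
  rw [Real.norm_of_nonneg (by positivity)]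
  linarith

theorem summable_digit_term (hQ : IsBasicSequence Q) {d : ℕ → ℕ} (hd : ∀ i, d i < Q i) :
    Summable fun i => (d i : ℝ) / partialProd Q (i + 1) :=
  Summable.of_norm_bounded (summable_geometric_of_lt_one (by norm_num) (by norm_num))
    fun i => norm_digit_term_le hQ (hd i)

theorem continuous_realize (hQ : IsBasicSequence Q) {X : Type*} [TopologicalSpace X]
    {d : X → ℕ → ℕ} (hd : ∀ x i, d x i < Q i) (hc : ∀ i, Continuous fun x => d x i) :
    Continuous fun x => realize Q (d x) :=
  continuous_tsum (fun i => ((continuous_of_discreteTopology (f := ((↑) : ℕ → ℝ))).comp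
    (hc i)).div_const _) (summable_geometric_of_lt_one (by norm_num) (by norm_num))
    fun i x => norm_digit_term_le hQ (hd x i)

/-- Avoiding the maximal digit everywhere makes the series a legitimate expansion, and avoiding it
at the first position keeps the sum below `1`. Uniqueness of the expansion does the rest. -/
theorem digit_realize (hQ : IsBasicSequence Q) {d : ℕ → ℕ} (hd : ∀ i, d i + 2 ≤ Q i) :
    digit Q (realize Q d) = d := by
  have hlt : ∀ i, d i < Q i := fun i => by have := hd i; omega
  have hP := partialProd_pos hQ
  have h1 : ∀ n, ∑ i ∈ Finset.range (n + 1), (d i : ℝ) / partialProd Q (i + 1) ≤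
      1 - 1 / partialProd Q 1 - 1 / partialProd Q (n + 1) := by
    intro n
    induction n with
    | zero =>
      have h2 : (d 0 : ℝ) + 2 ≤ Q 0 := by exact_mod_cast hd 0
      have h3 : (partialProd Q 1 : ℝ) = Q 0 := by simp [partialProd]
      have h4 := hP 1
      simp only [zero_add, Finset.range_one, Finset.sum_singleton]
      have h5 : (d 0 : ℝ) / partialProd Q 1 + 1 / partialProd Q 1 + 1 / partialProd Q 1 ≤ 1 := by
        rw [← add_div, ← add_div, div_le_one h4]
        linarith
      linarith
    | succ n ih =>
      rw [Finset.sum_range_succ]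
      linarith [digit_term_le hQ (hlt (n + 1))]
  have h2 : realize Q d ≤ 1 - 1 / partialProd Q 1 := by
    refine Real.tsum_le_of_sum_range_le (fun i => by positivity) fun n => ?_
    have h3 := h1 n
    rw [Finset.sum_range_succ] at h3
    have h4 := one_div_pos.2 (hP (n + 1))
    have h5 : (0 : ℝ) ≤ (d n : ℝ) / partialProd Q (n + 1) := by positivity
    linarith
  have h3 : 0 ≤ realize Q d := tsum_nonneg fun i => by positivity
  have h4 : IsExpansion Q (realize Q d) 0 d := by
    refine ⟨?_, hlt, fun n => ⟨n, le_rfl, ?_⟩, ?_⟩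
    · symm
      rw [Int.floor_eq_zero_iff]
      exact ⟨h3, by linarith [one_div_pos.2 (hP 1)]⟩
    · have := hd n
      omega
    · rw [Int.cast_zero, sub_zero]
      exact (summable_digit_term hQ hlt).hasSum
  exact (h4.eq_digit hQ).symm

end Realize

/-! ### The modified digits and their block counts -/

section NewDigit

/-- The `j`-th term of `w` lies in the interval that is selected by `u` for its window. -/
def Hit (W : ℕ → ℕ) (w : ℕ → ℝ) (c : ℝ) (u : ℕ → ℕ) (j : ℕ) : Prop :=
  w j ∈ tailInterval c (u (windowIndex W j))

open Classical in
/-- The digits of `w`, modified as follows. In the windows on which `x` is small many digits close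
to the upper end are moved to the middle, in those on which `y` is small many digits `0` are
changed to `1`, and in those on which `z` is small many small digits are removed. -/
def newDigit (Q W : ℕ → ℕ) (w : ℕ → ℝ) (x y z : ℕ → ℕ) (j : ℕ) : ℕ :=
  min (Q j - 2) (if Hit W w 1 x j then Q j / 2 else
    if rawDigit Q w j < (Q j).sqrt ∧ Hit W w (3 / 4) z (j + 1) then (Q j).sqrt else
    if rawDigit Q w j = 0 ∧ Hit W w 1 y (j + 1) then 1 else rawDigit Q w j)

variable {Q W : ℕ → ℕ} {w : ℕ → ℝ} {x y z : ℕ → ℕ}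

theorem newDigit_add_two_le (hQ : IsBasicSequence Q) (j : ℕ) :
    newDigit Q W w x y z j + 2 ≤ Q j := by
  have := hQ j
  have h : newDigit Q W w x y z j ≤ Q j - 2 := min_le_left _ _
  omega

/-- With `w` fixed, the digit depends on just one value of each of the three sequences. -/
theorem continuous_newDigit (Q W : ℕ → ℕ) (w : ℕ → ℝ) (j : ℕ) :
    Continuous fun p : (ℕ → ℕ) × (ℕ → ℕ) × (ℕ → ℕ) => newDigit Q W w p.1 p.2.1 p.2.2 j := by
  classical
  let F : ℕ × ℕ × ℕ → ℕ := fun r =>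
    min (Q j - 2) (if w j ∈ tailInterval 1 r.1 then Q j / 2 else
    if rawDigit Q w j < (Q j).sqrt ∧ w (j + 1) ∈ tailInterval (3 / 4) r.2.2 then (Q j).sqrt else
    if rawDigit Q w j = 0 ∧ w (j + 1) ∈ tailInterval 1 r.2.1 then 1 else rawDigit Q w j)
  have hF : Continuous F := continuous_of_discreteTopology
  have h1 : Continuous fun p : (ℕ → ℕ) × (ℕ → ℕ) × (ℕ → ℕ) =>
      (p.1 (windowIndex W j), p.2.1 (windowIndex W (j + 1)), p.2.2 (windowIndex W (j + 1))) := by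
    fun_prop
  convert hF.comp h1 using 2 with p
  simp only [newDigit, Hit, F, Function.comp]
  congr

/-- The summand `4` in the length keeps the intervals ending at `1` and at `3 / 4` disjoint and
inside `[1 / 2, 1)`. -/
theorem bounds_of_mem_tailInterval {c v : ℝ} {r : ℕ} (h : v ∈ tailInterval c r) : c - 1 / 4 ≤ v ∧ v < c := by
  refine ⟨le_trans ?_ h.1, h.2⟩
  have : (1 : ℝ) / (r + 4) ≤ 1 / 4 := by
    gcongr
    linarith [(Nat.cast_nonneg r : (0 : ℝ) ≤ r)]
  linarith

theorem lt_half_of_rawDigit_lt {M j : ℕ} (hM : 2 * M ≤ Q j) (hw : 0 ≤ w j) (hM0 : 0 < M)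
    (h : rawDigit Q w j < M) : w j < 1 / 2 := by
  have h1 := (Nat.floor_lt (mul_nonneg (Nat.cast_nonneg _) hw)).1 h
  have h2 : (2 : ℝ) * M ≤ Q j := by exact_mod_cast hM
  have h3 : (0 : ℝ) < M := by exact_mod_cast hM0
  by_contra! h4
  nlinarith

/-- For digits below `M`, the replacements `Q j / 2` and `√(Q j)` are too large to matter as values,
the truncation at `Q j - 2` is invisible, and `x` selects only terms whose digit is large anyway.
What remains is removal by `z` and the change from `0` to `1` by `y`, which exclude each other. -/
theorem newDigit_eq_iff {M j : ℕ} (hw : 0 ≤ w j) (hM2 : 2 ≤ M) (h1 : M ≤ (Q j).sqrt)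
    (h2 : 2 * M ≤ Q j) (h3 : M + 2 ≤ Q j) {e : ℕ} (he : e < M) :
    newDigit Q W w x y z j = e ↔
      (rawDigit Q w j = e ∧ ¬ Hit W w (3 / 4) z (j + 1) ∧ ¬ (e = 0 ∧ Hit W w 1 y (j + 1))) ∨
      (e = 1 ∧ rawDigit Q w j = 0 ∧ Hit W w 1 y (j + 1)) := by
  have hX : Hit W w 1 x j → M ≤ rawDigit Q w j := by
    intro h
    by_contra! h'
    have := lt_half_of_rawDigit_lt h2 hw (by omega) h'
    have := (bounds_of_mem_tailInterval h).1
    norm_num at this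
    linarith
  have hYZ : Hit W w 1 y (j + 1) → ¬ Hit W w (3 / 4) z (j + 1) := by
    intro h h'
    have h4 := (bounds_of_mem_tailInterval h).1
    have h5 := (bounds_of_mem_tailInterval h').2
    norm_num at h4
    linarith
  unfold newDigit
  by_cases hx : Hit W w 1 x j
  · have := hX hx
    rw [if_pos hx]
    constructor
    · intro h; omega
    · rintro (⟨h, -⟩ | ⟨-, h, -⟩) <;> omega
  rw [if_neg hx]
  by_cases hy : Hit W w 1 y (j + 1)
  · have hz := hYZ hy
    simp only [hy, hz, and_false, and_true, if_false, not_false_eq_true, true_and]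
    split_ifs <;> omega
  · by_cases hz : Hit W w (3 / 4) z (j + 1)
    · simp only [hy, hz, and_false, and_true, if_false, not_true_eq_false, false_and, or_false,
        iff_false]
      split_ifs <;> omega
    · simp only [hy, hz, and_false, and_true, if_false, not_false_eq_true, or_false]
      omega

theorem not_hit_of_rawDigit_lt {M j : ℕ} (hM : 2 * M ≤ Q j) (hw : 0 ≤ w j) (hM0 : 0 < M)
    (h : rawDigit Q w j < M) (u : ℕ → ℕ) : ¬ Hit W w 1 u j ∧ ¬ Hit W w (3 / 4) u j := by
  have h1 := lt_half_of_rawDigit_lt hM hw hM0 h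
  constructor <;> intro h2 <;> have h3 := (bounds_of_mem_tailInterval h2).1 <;> norm_num at h3 <;> linarith

/-- The effect on the number of occurrences of a block with last digit `e` of changing a
digit `0` to `1` at the end of the block. -/
def changeSign (e : ℕ) : ℝ := if e = 1 then 1 else if e = 0 then -1 else 0

/-- An inner digit of a block is followed by a small digit, hence by a term below `1 / 2`, which
triggers no change. So only the last digit can change: `z` removes occurrences of `B`, while `y`
removes them if `B` ends in `0` and creates them, from blocks ending in `0`, if `B` ends in `1`. -/
theorem ind_occurs_newDigit (hlim : InfiniteInLimit Q) (hw : ∀ i, 0 ≤ w i) {k : ℕ}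
    (B : Fin (k + 1) → ℕ) : ∀ᶠ i in atTop,
    ind (Occurs (newDigit Q W w x y z) B i) = ind (Occurs (rawDigit Q w) B i) -
      ind (Occurs (rawDigit Q w) B i ∧ Hit W w (3 / 4) z (i + (k + 1))) +
      changeSign (B (Fin.last k)) * ind (Occurs (rawDigit Q w) (Function.update B (Fin.last k) 0) i ∧
        Hit W w 1 y (i + (k + 1))) := by
  obtain ⟨M, hM2, hM⟩ : ∃ M, 2 ≤ M ∧ ∀ t, B t < M :=
    ⟨Finset.univ.sup B + 2, by omega, fun t => by
      have := Finset.le_sup (f := B) (Finset.mem_univ t)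
      omega⟩
  -- This bound secures `M ≤ √q`, `2 * M ≤ q` and `M + 2 ≤ q` simultaneously.
  obtain ⟨N, hN⟩ := eventually_atTop.1 (hlim.eventually_ge_atTop (M * M + 2 * M + 2))
  filter_upwards [eventually_ge_atTop N] with i hi
  have hq : ∀ j, i ≤ j → M ≤ (Q j).sqrt ∧ 2 * M ≤ Q j ∧ M + 2 ≤ Q j := fun j hj => by
    have := hN j (hi.trans hj)
    exact ⟨Nat.le_sqrt.2 (by omega), by nlinarith, by nlinarith⟩
  have hiff : ∀ j, i ≤ j → ∀ e < M, (newDigit Q W w x y z j = e ↔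
      (rawDigit Q w j = e ∧ ¬ Hit W w (3 / 4) z (j + 1) ∧ ¬ (e = 0 ∧ Hit W w 1 y (j + 1))) ∨
      (e = 1 ∧ rawDigit Q w j = 0 ∧ Hit W w 1 y (j + 1))) := fun j hj e he =>
    newDigit_eq_iff (hw j) hM2 (hq j hj).1 (hq j hj).2.1 (hq j hj).2.2 he
  have hnot : ∀ j, i ≤ j → rawDigit Q w j < M →
      ∀ u, ¬ Hit W w 1 u j ∧ ¬ Hit W w (3 / 4) u j := fun j hj h u =>
    not_hit_of_rawDigit_lt (hq j hj).2.1 (hw j) (by omega) h u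
  have hsmall : ∀ j, i ≤ j → newDigit Q W w x y z j < M → rawDigit Q w j < M := by
    intro j hj h
    rcases (hiff j hj _ h).1 rfl with h' | h' <;> omega
  set e := B (Fin.last k) with he
  set pre : Prop := ∀ t : Fin k, rawDigit Q w (i + t) = B t.castSucc with hpre
  have hocc : Occurs (rawDigit Q w) B i ↔ pre ∧ rawDigit Q w (i + k) = e := by
    simp only [Occurs, Fin.forall_fin_succ', Fin.val_castSucc, Fin.val_last, pre, he]
  have hocc0 : Occurs (rawDigit Q w) (Function.update B (Fin.last k) 0) i ↔
      pre ∧ rawDigit Q w (i + k) = 0 := by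
    simp only [Occurs, Fin.forall_fin_succ', Fin.val_castSucc, Fin.val_last, pre,
      Function.update_self, Function.update_of_ne (Fin.castSucc_lt_last _).ne]
  have hstep : (∀ t : Fin (k + 1), rawDigit Q w (i + t) < M) → ∀ t : Fin k,
      (newDigit Q W w x y z (i + t) = B t.castSucc ↔ rawDigit Q w (i + t) = B t.castSucc) := by
    intro h t
    have h1 := h t.succ
    rw [Fin.val_succ] at h1
    have h2 := hnot (i + (t + 1)) (by omega) h1
    have h3 := (h2 y).1
    have h4 := (h2 z).2
    rw [hiff (i + t) (by omega) _ (hM _)]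
    simp only [add_assoc, h3, h4, and_false, not_false_eq_true, and_true, or_false]
  have hnew : Occurs (newDigit Q W w x y z) B i ↔ pre ∧ newDigit Q W w x y z (i + k) = e := by
    constructor
    · intro h
      have h1 : ∀ t : Fin (k + 1), rawDigit Q w (i + t) < M := fun t =>
        hsmall _ (by omega) (by rw [h t]; exact hM t)
      exact ⟨fun t => (hstep h1 t).1 (h t.castSucc), h (Fin.last k)⟩
    · rintro ⟨h1, h2⟩
      have h3 : ∀ t : Fin (k + 1), rawDigit Q w (i + t) < M := by
        rw [Fin.forall_fin_succ']
        refine ⟨fun t => ?_, hsmall _ (by omega) ?_⟩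
        · rw [Fin.val_castSucc, h1 t]; exact hM _
        · rw [Fin.val_last, h2]; exact hM _
      rw [Occurs, Fin.forall_fin_succ']
      exact ⟨fun t => (hstep h3 t).2 (h1 t), h2⟩
  rw [hnew, hocc, hocc0, hiff (i + k) (by omega) e (hM _), ← add_assoc]
  have hYZ : Hit W w 1 y (i + k + 1) → ¬ Hit W w (3 / 4) z (i + k + 1) := by
    intro h h'
    have h4 := (bounds_of_mem_tailInterval h).1
    have h5 := (bounds_of_mem_tailInterval h').2
    norm_num at h4
    linarith
  unfold changeSign ind
  by_cases hp : pre
  · by_cases hy : Hit W w 1 y (i + k + 1)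
    · have hz := hYZ hy
      by_cases h0 : rawDigit Q w (i + k) = 0
      · rcases Nat.lt_or_ge e 2 with h2 | h2
        · interval_cases e <;> simp [hp, hy, hz, h0]
        · have h3 : ¬ 0 = e := by omega
          have h4 : e ≠ 1 := by omega
          have h5 : e ≠ 0 := by omega
          simp [hp, hy, hz, h0, h3, h4, h5]
      · by_cases h1 : rawDigit Q w (i + k) = e
        · have h5 : e ≠ 0 := h1 ▸ h0
          simp [hp, hy, hz, h1, h5]
        · simp [hp, hy, hz, h0, h1]
    · by_cases hz : Hit W w (3 / 4) z (i + k + 1) <;>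
      by_cases h1 : rawDigit Q w (i + k) = e <;> simp [hp, hy, hz, h1]
  · simp [hp]

theorem IsGeneric.isLittleO_count_occurs (h : IsGeneric Q w) {k : ℕ} (hk : KDivergent Q k)
    (B : Fin k → ℕ) :
    (fun n => count (Occurs (rawDigit Q w) B) n - divergenceSum Q k n) =o[atTop]
      fun n => divergenceSum Q k n := by
  have h1 := h.isLittleO k hk B 0 1 le_rfl zero_lt_one le_rfl
  refine h1.congr_left fun n => ?_
  simp only [Rat.cast_zero, Rat.cast_one, h.mem_Ico, and_true, sub_zero, one_mul]

theorem IsGeneric.isLittleO_count_hit (h : IsGeneric Q w) (hQ : IsBasicSequence Q)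
    (hW : IsWindowSequence Q W) {k : ℕ} (hk : KDivergent Q k) (B : Fin k → ℕ) {c : ℚ}
    (hc : 1 / 4 ≤ c) (hc1 : c ≤ 1) (u : ℕ → ℕ) :
    (fun n => count (fun i => Occurs (rawDigit Q w) B i ∧ Hit W w c u (i + k)) n -
      expectedHits Q W k u n) =o[atTop] fun n => divergenceSum Q k n := by
  refine isLittleO_count_sub_expectedHits hQ hW hk (fun r => ?_) u
  have hr : (1 : ℚ) / (r + 4) ≤ 1 / 4 := by
    gcongr
    linarith [(Nat.cast_nonneg r : (0 : ℚ) ≤ r)]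
  have hr0 : (0 : ℚ) < 1 / (r + 4) := by positivity
  have h1 := h.isLittleO k hk B (c - 1 / (r + 4)) c (by linarith) (by linarith) hc1
  refine h1.congr_left fun n => ?_
  simp only [tailInterval]
  push_cast
  ring

theorem isLittleO_count_newDigit (h : IsGeneric Q w) (hQ : IsBasicSequence Q)
    (hlim : InfiniteInLimit Q) (hW : IsWindowSequence Q W) {k : ℕ} (hk : KDivergent Q (k + 1))
    (B : Fin (k + 1) → ℕ) :
    (fun n => count (Occurs (newDigit Q W w x y z) B) n - (divergenceSum Q (k + 1) n -
      expectedHits Q W (k + 1) z n + changeSign (B (Fin.last k)) * expectedHits Q W (k + 1) y n))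
      =o[atTop] fun n => divergenceSum Q (k + 1) n := by
  have h1 := isLittleO_sum_sub_sum
    (ind_occurs_newDigit (W := W) (x := x) (y := y) (z := z) hlim (fun i => (h.mem_Ico i).1) B) hk
  have h2 := h.isLittleO_count_occurs hk B
  have h3 := h.isLittleO_count_hit hQ hW hk B (c := 3 / 4) (by norm_num) (by norm_num) z
  have h4 := (h.isLittleO_count_hit hQ hW hk (Function.update B (Fin.last k) 0) (c := 1)
    (by norm_num) (by norm_num) y).const_mul_left (changeSign (B (Fin.last k)))
  refine (((h1.add h2).sub h3).add h4).congr_left fun n => ?_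
  simp only [Finset.sum_add_distrib, Finset.sum_sub_distrib, ← Finset.mul_sum, count]
  push_cast
  ring

end NewDigit

end CantorSeries

end

noncomputable section

namespace CantorSeries

open Asymptotics

/-! ### Normality and ratio normality of the modified number -/

section Counts

variable {Q W : ℕ → ℕ} {w : ℕ → ℝ} {x y z : ℕ → ℕ}

theorem expectedCount_le_divergenceSum (Q : ℕ → ℕ) {k : ℕ} (B : Fin k → ℕ) (n : ℕ) :
    expectedCount Q B n ≤ divergenceSum Q k n :=
  Finset.sum_le_sum fun i _ => by
    split_ifs
    · exact le_rfl
    · positivity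

theorem isLittleO_expectedCount_sub (hlim : InfiniteInLimit Q) {k : ℕ} (hk : KDivergent Q k)
    (B : Fin k → ℕ) : (fun n => expectedCount Q B n - divergenceSum Q k n) =o[atTop]
      fun n => divergenceSum Q k n :=
  isLittleO_sum_sub_sum ((eventually_lt_of_infiniteInLimit hlim B).mono fun i hi => by
    rw [if_pos hi]) hk

/-- Blocks of length `k` are all eventually admissible, so the hypothesis on `B` in the definitions
of normality reduces to a condition on `k`. -/
theorem tendsto_expectedCount_iff (hlim : InfiniteInLimit Q) {k : ℕ} (B : Fin k → ℕ) :
    Tendsto (fun n => expectedCount Q B n) atTop atTop ↔ KDivergent Q k :=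
  ⟨fun h => tendsto_atTop_mono (expectedCount_le_divergenceSum Q B) h, fun h =>
    IsEquivalent.tendsto_atTop (IsEquivalent.symm (isLittleO_expectedCount_sub hlim h B)) h⟩

/-- The expected proportion of blocks of length `k` that are changed. -/
def hitRatio (Q W : ℕ → ℕ) (k : ℕ) (u : ℕ → ℕ) (n : ℕ) : ℝ :=
  expectedHits Q W k u n / divergenceSum Q k n

theorem hitRatio_nonneg (Q W : ℕ → ℕ) (k : ℕ) (u : ℕ → ℕ) (n : ℕ) : 0 ≤ hitRatio Q W k u n :=
  div_nonneg (expectedHits_nonneg _ _ _ _ _) (divergenceSum_nonneg _ _ _)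

theorem hitRatio_le (Q W : ℕ → ℕ) (k : ℕ) (u : ℕ → ℕ) (n : ℕ) : hitRatio Q W k u n ≤ 1 / 4 :=
  div_le_of_le_mul₀ (divergenceSum_nonneg _ _ _) (by norm_num) (expectedHits_le _ _ _ _ _)

theorem tendsto_hitRatio_iff (hQ : IsBasicSequence Q) (hW : IsWindowSequence Q W) {k : ℕ}
    (hk : KDivergent Q k) (u : ℕ → ℕ) :
    Tendsto (hitRatio Q W k u) atTop (𝓝 0) ↔ Tendsto u atTop atTop := by
  rw [← expectedHits_isLittleO_iff hQ hW hk u, isLittleO_iff_tendsto']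
  · rfl
  · filter_upwards [hk.eventually_gt_atTop 0] with n hn h
    exact absurd h hn.ne'

/-- The number with the digits `newDigit Q W w x y z`. -/
def modified (Q W : ℕ → ℕ) (w : ℕ → ℝ) (x y z : ℕ → ℕ) : ℝ :=
  realize Q (newDigit Q W w x y z)

theorem digit_modified (hQ : IsBasicSequence Q) :
    digit Q (modified Q W w x y z) = newDigit Q W w x y z :=
  digit_realize hQ fun i => newDigit_add_two_le hQ i

theorem blockCount_modified (hQ : IsBasicSequence Q) {k : ℕ} (B : Fin k → ℕ) (n : ℕ) :
    (blockCount Q B (modified Q W w x y z) n : ℝ) = count (Occurs (newDigit Q W w x y z) B) n := by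
  rw [blockCount, digit_modified hQ]
  exact (count_eq_card (fun i => ∀ t : Fin k, newDigit Q W w x y z (i + t) = B t) n).symm

/-- The relative frequency of `B` is, up to `o(1)`, a loss due to `z` common to all blocks plus a
correction due to `y` that depends on the last digit alone. -/
theorem tendsto_blockCount_modified (h : IsGeneric Q w) (hQ : IsBasicSequence Q)
    (hlim : InfiniteInLimit Q) (hW : IsWindowSequence Q W) {k : ℕ} (hk : KDivergent Q (k + 1))
    (B : Fin (k + 1) → ℕ) :
    Tendsto (fun n => (blockCount Q B (modified Q W w x y z) n : ℝ) / expectedCount Q B n -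
      (1 - hitRatio Q W (k + 1) z n + changeSign (B (Fin.last k)) * hitRatio Q W (k + 1) y n))
      atTop (𝓝 0) := by
  set R : ℕ → ℝ := fun n => divergenceSum Q (k + 1) n
  set ρ : ℕ → ℝ := fun n =>
    1 - hitRatio Q W (k + 1) z n + changeSign (B (Fin.last k)) * hitRatio Q W (k + 1) y n with hρ
  have hexp := isLittleO_expectedCount_sub hlim hk B
  have htop := (tendsto_expectedCount_iff hlim B).2 hk
  have hR : R =O[atTop] fun n => expectedCount Q B n :=
    (IsEquivalent.symm hexp).isBigO
  have hρ1 : ρ =O[atTop] fun _ => (1 : ℝ) := by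
    refine IsBigO.of_bound 2 (Eventually.of_forall fun n => ?_)
    have h1 := hitRatio_nonneg Q W (k + 1) z n
    have h2 := hitRatio_le Q W (k + 1) z n
    have h3 := hitRatio_nonneg Q W (k + 1) y n
    have h4 := hitRatio_le Q W (k + 1) y n
    rw [Real.norm_eq_abs, norm_one, abs_le]
    simp only [hρ, changeSign]
    split_ifs <;> constructor <;> linarith
  have h1 : (fun n => count (Occurs (newDigit Q W w x y z) B) n - ρ n * R n) =o[atTop] R := by
    refine (isLittleO_count_newDigit (x := x) (y := y) (z := z) h hQ hlim hW hk B).congr' ?_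
      EventuallyEq.rfl
    filter_upwards [hk.eventually_gt_atTop 0] with n hn
    simp only [hρ, R, hitRatio]
    field_simp
  have h2 : (fun n => ρ n * (R n - expectedCount Q B n)) =o[atTop] R := by
    simpa using hρ1.mul_isLittleO (hexp.neg_left.congr_left fun n => neg_sub _ _)
  have h3 := ((h1.add h2).trans_isBigO hR).tendsto_div_nhds_zero
  refine h3.congr' ?_
  filter_upwards [htop.eventually_gt_atTop 0] with n hn
  rw [blockCount_modified hQ]
  field_simp
  ring

theorem tendsto_mul_zero_of_bounded {f g : ℕ → ℝ} {C : ℝ} (hf : Tendsto f atTop (𝓝 0))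
    (hg : ∀ᶠ n in atTop, |g n| ≤ C) : Tendsto (fun n => f n * g n) atTop (𝓝 0) := by
  have h1 : g =O[atTop] fun _ => (1 : ℝ) :=
    IsBigO.of_bound C (hg.mono fun n hn => by simpa using hn)
  have h2 := ((isLittleO_one_iff ℝ).2 hf).mul_isBigO h1
  simpa using h2

theorem tendsto_div_one_iff {a b : ℕ → ℝ} (hb : ∀ᶠ n in atTop, 1 / 4 ≤ b n ∧ b n ≤ 2) :
    Tendsto (fun n => a n / b n) atTop (𝓝 1) ↔ Tendsto (fun n => a n - b n) atTop (𝓝 0) := by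
  constructor
  · intro h
    have h1 : Tendsto (fun n => a n / b n - 1) atTop (𝓝 0) := by simpa using h.sub_const 1
    refine (tendsto_mul_zero_of_bounded (g := b) (C := 2) h1 ?_).congr' ?_
    · filter_upwards [hb] with n hn
      rw [abs_le]; constructor <;> linarith [hn.1, hn.2]
    · filter_upwards [hb] with n hn
      have : b n ≠ 0 := by linarith [hn.1]
      field_simp
  · intro h
    have h1 := tendsto_mul_zero_of_bounded (g := fun n => (b n)⁻¹) (C := 4) h (by
      filter_upwards [hb] with n hn
      have h2 : 0 < b n := by linarith [hn.1]
      rw [abs_of_pos (inv_pos.2 h2)]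
      exact inv_le_of_inv_le₀ (by norm_num) (by linarith [hn.1]))
    have h3 := h1.add_const 1
    rw [zero_add] at h3
    refine h3.congr' ?_
    filter_upwards [hb] with n hn
    have : b n ≠ 0 := by linarith [hn.1]
    field_simp
    ring

theorem modified_mem_NSet_iff (h : IsGeneric Q w) (hQ : IsBasicSequence Q)
    (hlim : InfiniteInLimit Q) (hdiv : KDivergent Q 1) (hW : IsWindowSequence Q W) :
    modified Q W w x y z ∈ NSet Q ↔ Tendsto y atTop atTop ∧ Tendsto z atTop atTop := by
  constructor
  · intro hN
    have key : ∀ e : ℕ, Tendsto (fun n => hitRatio Q W 1 z n - changeSign e * hitRatio Q W 1 y n)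
        atTop (𝓝 0) := fun e => by
      have h1 := hN 1 le_rfl (fun _ => e) ((tendsto_expectedCount_iff hlim _).2 hdiv)
      have h2 := tendsto_blockCount_modified (x := x) (y := y) (z := z) h hQ hlim hW
        (k := 0) hdiv (fun _ => e)
      have h3 := (h2.sub h1).add_const 1
      rw [zero_sub, neg_add_cancel] at h3
      exact h3.congr fun n => by ring
    -- The digit `2` is unaffected by `y` and isolates `z`; the digit `1` then yields `y`.
    have hz : Tendsto (hitRatio Q W 1 z) atTop (𝓝 0) :=
      (key 2).congr fun n => by simp [changeSign]
    have hy : Tendsto (hitRatio Q W 1 y) atTop (𝓝 0) := by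
      have := hz.sub (key 1)
      rw [sub_zero] at this
      exact this.congr fun n => by simp [changeSign]
    exact ⟨(tendsto_hitRatio_iff hQ hW hdiv y).1 hy, (tendsto_hitRatio_iff hQ hW hdiv z).1 hz⟩
  · rintro ⟨hy, hz⟩ k hk B hB
    obtain ⟨k, rfl⟩ := Nat.exists_eq_add_of_le' hk
    have hkd := (tendsto_expectedCount_iff hlim B).1 hB
    have h1 := tendsto_blockCount_modified (x := x) (y := y) (z := z) h hQ hlim hW hkd B
    have h2 := (tendsto_hitRatio_iff hQ hW hkd y).2 hy
    have h3 := (tendsto_hitRatio_iff hQ hW hkd z).2 hz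
    have h4 := h1.add ((h3.const_sub 1).add (h2.const_mul (changeSign (B (Fin.last k)))))
    rw [mul_zero, add_zero, zero_add, sub_zero] at h4
    exact h4.congr fun n => by ring

/-- The relative frequencies stay away from `0` and are bounded, so a ratio tends to `1` iff the
difference tends to `0`. In the difference the loss due to `z` cancels. -/
theorem modified_mem_RNSet_iff (h : IsGeneric Q w) (hQ : IsBasicSequence Q)
    (hlim : InfiniteInLimit Q) (hdiv : KDivergent Q 1) (hW : IsWindowSequence Q W) :
    modified Q W w x y z ∈ RNSet Q ↔ Tendsto y atTop atTop := by
  let r : ∀ k : ℕ, (Fin k → ℕ) → ℕ → ℝ := fun k B n =>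
    (blockCount Q B (modified Q W w x y z) n : ℝ) / expectedCount Q B n
  -- Both hit ratios are at most `1 / 4`; with an error below `1 / 4` the frequency is at least `1 -
  -- 3 / 4`.
  have hbd : ∀ k, KDivergent Q (k + 1) → ∀ B : Fin (k + 1) → ℕ,
      ∀ᶠ n in atTop, 1 / 4 ≤ r _ B n ∧ r _ B n ≤ 2 := fun k hk B => by
    have h1 := tendsto_blockCount_modified (x := x) (y := y) (z := z) h hQ hlim hW hk B
    have h2 := h1.eventually (Ioo_mem_nhds (show (-(1 / 4) : ℝ) < 0 by norm_num)
      (show (0 : ℝ) < 1 / 4 by norm_num))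
    filter_upwards [h2] with n hn
    have h3 := hitRatio_nonneg Q W (k + 1) z n
    have h4 := hitRatio_le Q W (k + 1) z n
    have h5 := hitRatio_nonneg Q W (k + 1) y n
    have h6 := hitRatio_le Q W (k + 1) y n
    have h7 : -hitRatio Q W (k + 1) y n ≤ changeSign (B (Fin.last k)) * hitRatio Q W (k + 1) y n ∧
        changeSign (B (Fin.last k)) * hitRatio Q W (k + 1) y n ≤ hitRatio Q W (k + 1) y n := by
      unfold changeSign
      split_ifs <;> constructor <;> linarith
    simp only [r]
    constructor <;> linarith [hn.1, hn.2, h7.1, h7.2]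
  have hiff : ∀ k, KDivergent Q (k + 1) → ∀ B₁ B₂ : Fin (k + 1) → ℕ,
      (Tendsto (fun n => r _ B₁ n / r _ B₂ n) atTop (𝓝 1) ↔
        Tendsto (fun n => (changeSign (B₁ (Fin.last k)) - changeSign (B₂ (Fin.last k))) *
          hitRatio Q W (k + 1) y n) atTop (𝓝 0)) := fun k hk B₁ B₂ => by
    have h1 := tendsto_blockCount_modified (x := x) (y := y) (z := z) h hQ hlim hW hk B₁
    have h2 := tendsto_blockCount_modified (x := x) (y := y) (z := z) h hQ hlim hW hk B₂
    have h3 := h1.sub h2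
    rw [sub_zero] at h3
    rw [tendsto_div_one_iff (hbd k hk B₂)]
    constructor
    · intro h4
      have h5 := h4.sub h3
      rw [sub_zero] at h5
      exact h5.congr fun n => by simp only [r]; ring
    · intro h4
      have h5 := h4.add h3
      rw [zero_add] at h5
      exact h5.congr fun n => by simp only [r]; ring
  constructor
  · intro hRN
    have hmin : Tendsto (fun n => min (expectedCount Q (fun _ : Fin 1 => 1) n)
        (expectedCount Q (fun _ : Fin 1 => 0) n)) atTop atTop :=
      tendsto_atTop.2 fun c => by
        filter_upwards [((tendsto_expectedCount_iff hlim fun _ : Fin 1 => 1).2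
          hdiv).eventually_ge_atTop c, ((tendsto_expectedCount_iff hlim fun _ : Fin 1 => 0).2
          hdiv).eventually_ge_atTop c] with n h1 h2 using le_min h1 h2
    -- The digits `1` and `0` have opposite signs, so the difference is twice the hit ratio of `y`.
    have h1 := (hiff 0 hdiv (fun _ => 1) (fun _ => 0)).1 (hRN 1 le_rfl _ _ hmin)
    refine (tendsto_hitRatio_iff hQ hW hdiv y).1 ?_
    have h2 := h1.div_const 2
    rw [zero_div] at h2
    refine h2.congr fun n => ?_
    simp only [changeSign]
    norm_num
  · intro hy k hk B₁ B₂ hB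
    obtain ⟨k, rfl⟩ := Nat.exists_eq_add_of_le' hk
    have hkd : KDivergent Q (k + 1) :=
      (tendsto_expectedCount_iff hlim B₁).1 (tendsto_atTop_mono (fun n => min_le_left _ _) hB)
    refine (hiff k hkd B₁ B₂).2 ?_
    simpa using ((tendsto_hitRatio_iff hQ hW hkd y).2 hy).const_mul
      (changeSign (B₁ (Fin.last k)) - changeSign (B₂ (Fin.last k)))

end Counts

/-! ### Uniform distribution via counts below rational thresholds, and its stability -/

section UniformDistribution

/-- The proportion of terms of `u` below `c` is `c`, for all rational numbers `c` in `(0, 1)`. -/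
def HasUniformCounts (u : ℕ → ℝ) : Prop :=
  ∀ c : ℚ, 0 < c → c < 1 →
    (fun n => count (fun i => u i < c) n - (c : ℝ) * n) =o[atTop] fun n : ℕ => (n : ℝ)

theorem count_le_add_of_eventually {P P' : ℕ → Prop} (h : ∀ᶠ i in atTop, P i → P' i) :
    ∃ C, ∀ n, count P n ≤ count P' n + C := by
  obtain ⟨N, hN⟩ := eventually_atTop.1 h
  refine ⟨∑ i ∈ Finset.range N, ind (P i), fun n => ?_⟩
  rcases le_total n N with hn | hn
  · have h1 : count P n ≤ ∑ i ∈ Finset.range N, ind (P i) :=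
      Finset.sum_le_sum_of_subset_of_nonneg (Finset.range_mono hn) fun _ _ _ => ind_nonneg _
    linarith [count_nonneg P' n]
  · rw [count, count, ← Finset.sum_range_add_sum_Ico _ hn, ← Finset.sum_range_add_sum_Ico _ hn]
    have h1 : ∑ i ∈ Finset.Ico N n, ind (P i) ≤ ∑ i ∈ Finset.Ico N n, ind (P' i) :=
      Finset.sum_le_sum fun i hi => ind_mono (hN i (Finset.mem_Ico.1 hi).1)
    have h2 : 0 ≤ ∑ i ∈ Finset.range N, ind (P' i) := Finset.sum_nonneg fun _ _ => ind_nonneg _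
    linarith

theorem count_of_forall {P : ℕ → Prop} (h : ∀ i, P i) (n : ℕ) : count P n = n := by
  simp [count, ind_of (h _)]

theorem count_of_forall_not {P : ℕ → Prop} (h : ∀ i, ¬ P i) (n : ℕ) : count P n = 0 := by
  simp [count, ind_of_not (h _)]

/-- A null perturbation eventually carries terms below `c` to terms below a slightly larger rational
`b`. Together with `lower`, this passes from rational to real thresholds and from `u` to `v`. -/
theorem HasUniformCounts.upper {u v : ℕ → ℝ} (hu : HasUniformCounts u)
    (huv : Tendsto (fun n => v n - u n) atTop (𝓝 0)) (hv : ∀ n, v n ∈ Set.Ico (0 : ℝ) 1)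
    {c ε : ℝ} (hc : 0 ≤ c) (hε : 0 < ε) :
    ∀ᶠ n in atTop, count (fun i => v i < c) n - c * n ≤ ε * n := by
  have hnat : Tendsto (fun n : ℕ => (n : ℝ)) atTop atTop := tendsto_natCast_atTop_atTop
  rcases le_or_gt 1 c with hc1 | hc1
  · filter_upwards with n
    rw [count_of_forall fun i => (hv i).2.trans_le hc1]
    have : (0 : ℝ) ≤ n := Nat.cast_nonneg n
    nlinarith
  · obtain ⟨b, hb1, hb2⟩ := exists_rat_btwn (show c < min 1 (c + ε / 3) by
      rw [lt_min_iff]; constructor <;> linarith)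
    rw [lt_min_iff] at hb2
    have hev : ∀ᶠ i in atTop, v i < c → u i < b := by
      filter_upwards [huv.eventually (Ioi_mem_nhds (show c - b < 0 by linarith))] with i hi h
      have : c - b < v i - u i := hi
      linarith
    obtain ⟨C, hC⟩ := count_le_add_of_eventually hev
    have h1 := isLittleO_iff.1 (hu b (by exact_mod_cast hc.trans_lt hb1) (by exact_mod_cast hb2.1))
      (show 0 < ε / 3 by positivity)
    filter_upwards [h1, (hnat.const_mul_atTop (show 0 < ε / 3 by positivity)).eventually_ge_atTop C]
      with n hn1 hn2
    have h0 : (0 : ℝ) ≤ n := Nat.cast_nonneg n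
    rw [Real.norm_eq_abs, Real.norm_of_nonneg h0, abs_le] at hn1
    have h2 := hC n
    nlinarith [hn1.2, hb2.2]

theorem HasUniformCounts.lower {u v : ℕ → ℝ} (hu : HasUniformCounts u)
    (huv : Tendsto (fun n => v n - u n) atTop (𝓝 0)) {c ε : ℝ} (hc : c ≤ 1) (hε : 0 < ε) :
    ∀ᶠ n in atTop, -(ε * n) ≤ count (fun i => v i < c) n - c * n := by
  have hnat : Tendsto (fun n : ℕ => (n : ℝ)) atTop atTop := tendsto_natCast_atTop_atTop
  rcases le_or_gt c 0 with hc1 | hc1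
  · filter_upwards with n
    have : (0 : ℝ) ≤ n := Nat.cast_nonneg n
    have := count_nonneg (fun i => v i < c) n
    nlinarith
  · obtain ⟨b, hb1, hb2⟩ := exists_rat_btwn (show max 0 (c - ε / 3) < c by
      rw [max_lt_iff]; constructor <;> linarith)
    rw [max_lt_iff] at hb1
    have hev : ∀ᶠ i in atTop, u i < b → v i < c := by
      filter_upwards [huv.eventually (Iio_mem_nhds (show 0 < c - b by linarith))] with i hi h
      have : v i - u i < c - b := hi
      linarith
    obtain ⟨C, hC⟩ := count_le_add_of_eventually hev
    have h1 := isLittleO_iff.1 (hu b (by exact_mod_cast hb1.1) (by exact_mod_cast hb2.trans_le hc))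
      (show 0 < ε / 3 by positivity)
    filter_upwards [h1, (hnat.const_mul_atTop (show 0 < ε / 3 by positivity)).eventually_ge_atTop C]
      with n hn1 hn2
    have h0 : (0 : ℝ) ≤ n := Nat.cast_nonneg n
    rw [Real.norm_eq_abs, Real.norm_of_nonneg h0, abs_le] at hn1
    have h2 := hC n
    nlinarith [hn1.1, hb1.2]

theorem count_fract_mem_Ico {v : ℕ → ℝ} (hv : ∀ n, v n ∈ Set.Ico (0 : ℝ) 1) {a b : ℝ} (hab : a ≤ b)
    (n : ℕ) : (((Finset.range n).filter fun i => Int.fract (v i) ∈ Set.Ico a b).card : ℝ) =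
      count (fun i => v i < b) n - count (fun i => v i < a) n := by
  rw [← count_eq_card, count, count, count, ← Finset.sum_sub_distrib]
  refine Finset.sum_congr rfl fun i _ => ?_
  rw [Int.fract_eq_self.2 (hv i)]
  by_cases h1 : v i < a
  · rw [ind_of h1, ind_of (h1.trans_le hab), ind_of_not fun h => absurd h.1 (not_le.2 h1), sub_self]
  · rw [ind_of_not h1, sub_zero]
    by_cases h2 : v i < b
    · rw [ind_of h2, ind_of ⟨not_lt.1 h1, h2⟩]
    · rw [ind_of_not h2, ind_of_not fun h => h2 h.2]

theorem HasUniformCounts.uniformlyDistributedModOne {u v : ℕ → ℝ} (hu : HasUniformCounts u)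
    (huv : Tendsto (fun n => v n - u n) atTop (𝓝 0)) (hv : ∀ n, v n ∈ Set.Ico (0 : ℝ) 1) :
    UniformlyDistributedModOne v := by
  intro a b ha hab hb
  have key : ∀ c : ℝ, 0 ≤ c → c ≤ 1 →
      Tendsto (fun n : ℕ => count (fun i => v i < c) n / n) atTop (𝓝 c) := by
    intro c hc0 hc1
    have h1 : (fun n => count (fun i => v i < c) n - c * n) =o[atTop] fun n : ℕ => (n : ℝ) := by
      refine isLittleO_iff.2 fun ε hε => ?_
      filter_upwards [hu.upper huv hv hc0 hε, hu.lower huv hc1 hε] with n h1 h2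
      rw [Real.norm_eq_abs, Real.norm_of_nonneg (Nat.cast_nonneg n), abs_le]
      exact ⟨h2, h1⟩
    have h2 := h1.tendsto_div_nhds_zero.add_const c
    rw [zero_add] at h2
    refine h2.congr' ?_
    filter_upwards [eventually_gt_atTop 0] with n hn
    have : (0 : ℝ) < n := by exact_mod_cast hn
    field_simp
    ring
  refine ((key b (ha.trans hab.le) hb).sub (key a ha (hab.le.trans hb))).congr fun n => ?_
  rw [count_fract_mem_Ico hv hab.le, sub_div]

theorem UniformlyDistributedModOne.hasUniformCounts {v : ℕ → ℝ}
    (h : UniformlyDistributedModOne v) (hv : ∀ n, v n ∈ Set.Ico (0 : ℝ) 1) :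
    HasUniformCounts v := by
  intro c hc0 hc1
  have hc0' : (0 : ℝ) < c := by exact_mod_cast hc0
  have h1 := (h 0 c le_rfl hc0' (by exact_mod_cast hc1.le)).sub_const ((c : ℝ) - 0)
  rw [sub_self] at h1
  refine (isLittleO_iff_tendsto' ?_).2 (h1.congr' ?_)
  · filter_upwards [eventually_gt_atTop 0] with n hn h0
    exact absurd (by exact_mod_cast h0) hn.ne'
  · filter_upwards [eventually_gt_atTop 0] with n hn
    have : (0 : ℝ) < n := by exact_mod_cast hn
    rw [count_fract_mem_Ico hv hc0'.le, count_of_forall_not fun i => not_lt.2 (hv i).1]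
    field_simp
    ring

theorem uniformlyDistributedModOne_iff {v : ℕ → ℝ} (hv : ∀ n, v n ∈ Set.Ico (0 : ℝ) 1) :
    UniformlyDistributedModOne v ↔ HasUniformCounts v :=
  ⟨fun h => h.hasUniformCounts hv, fun h => h.uniformlyDistributedModOne (by simp) hv⟩

end UniformDistribution

/-! ### Distribution normality of the modified number -/

section Distribution

variable {Q W : ℕ → ℕ} {w : ℕ → ℝ} {x y z : ℕ → ℕ}

/-- The empty block occurs everywhere, so the case `k = 0` of genericity and of the window estimates
is about plain counts of positions. -/
theorem kDivergent_zero (Q : ℕ → ℕ) : KDivergent Q 0 := by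
  simpa [KDivergent, divergenceSum] using tendsto_natCast_atTop_atTop (R := ℝ)

theorem divergenceSum_zero (Q : ℕ → ℕ) (n : ℕ) : divergenceSum Q 0 n = n := by
  simp [divergenceSum]

open Classical in
/-- The sequence `w` in which the terms selected by `x` are moved to `1 / 2`. -/
def moved (W : ℕ → ℕ) (w : ℕ → ℝ) (x : ℕ → ℕ) (j : ℕ) : ℝ := if Hit W w 1 x j then 1 / 2 else w j

theorem moved_mem_Ico (h : IsGeneric Q w) (j : ℕ) : moved W w x j ∈ Set.Ico (0 : ℝ) 1 := by
  unfold moved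
  split_ifs
  · norm_num
  · exact h.mem_Ico j

theorem IsGeneric.hasUniformCounts (h : IsGeneric Q w) : HasUniformCounts w := by
  intro c hc0 hc1
  have h1 := h.isLittleO 0 (kDivergent_zero Q) Fin.elim0 0 c le_rfl hc0 hc1.le
  simpa only [divergenceSum_zero, Occurs, IsEmpty.forall_iff, true_and, Set.mem_Ico, add_zero,
    Rat.cast_zero, sub_zero, (h.mem_Ico _).1] using h1

theorem IsGeneric.isLittleO_count_hit_iff (h : IsGeneric Q w) (hQ : IsBasicSequence Q)
    (hW : IsWindowSequence Q W) :
    ((fun n => count (Hit W w 1 x) n) =o[atTop] fun n : ℕ => (n : ℝ)) ↔ Tendsto x atTop atTop := by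
  have h1 := h.isLittleO_count_hit hQ hW (kDivergent_zero Q) Fin.elim0 (c := 1) (by norm_num)
    le_rfl x
  rw [← expectedHits_isLittleO_iff hQ hW (kDivergent_zero Q)]
  simp only [divergenceSum_zero, Occurs, IsEmpty.forall_iff, true_and, add_zero, Rat.cast_one] at h1 ⊢
  exact ⟨fun h2 => (h2.sub h1).congr_left fun n => by ring,
    fun h2 => (h2.add h1).congr_left fun n => by ring⟩

/-- Every hit moves a term from `[3 / 4, 1)` to `1 / 2`. So the count below `3 / 4` grows by exactly
the number of hits, and no count changes by more than that. -/
theorem hasUniformCounts_moved_iff (h : IsGeneric Q w) (hQ : IsBasicSequence Q)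
    (hW : IsWindowSequence Q W) : HasUniformCounts (moved W w x) ↔ Tendsto x atTop atTop := by
  rw [← h.isLittleO_count_hit_iff hQ hW]
  constructor
  · intro hu
    have h1 := (hu (3 / 4) (by norm_num) (by norm_num)).sub
      (h.hasUniformCounts (3 / 4) (by norm_num) (by norm_num))
    refine h1.congr_left fun n => ?_
    rw [sub_sub_sub_cancel_right, count, count, count, ← Finset.sum_sub_distrib]
    refine Finset.sum_congr rfl fun i _ => ?_
    push_cast
    by_cases hi : Hit W w 1 x i
    · have h2 := (bounds_of_mem_tailInterval hi).1
      rw [ind_of hi, ind_of (by rw [moved, if_pos hi]; norm_num), ind_of_not (by linarith), sub_zero]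
    · rw [ind_of_not hi, moved, if_neg hi, sub_self]
  · intro hx c hc0 hc1
    have h1 : (fun n => count (fun i => moved W w x i < c) n - count (fun i => w i < c) n) =O[atTop]
        fun n => count (Hit W w 1 x) n := by
      refine IsBigO.of_bound 1 (Eventually.of_forall fun n => ?_)
      rw [one_mul, Real.norm_of_nonneg (count_nonneg _ _), Real.norm_eq_abs, count, count, count,
        ← Finset.sum_sub_distrib]
      refine (Finset.abs_sum_le_sum_abs _ _).trans (Finset.sum_le_sum fun i _ => ?_)
      by_cases hi : Hit W w 1 x i
      · rw [ind_of hi]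
        exact abs_sub_le_iff.2 ⟨by linarith [ind_le_one (moved W w x i < c), ind_nonneg (w i < c)],
          by linarith [ind_le_one (w i < c), ind_nonneg (moved W w x i < c)]⟩
      · rw [moved, if_neg hi, sub_self, abs_zero]
        exact ind_nonneg _
    exact ((h1.trans_isLittleO hx).add (h.hasUniformCounts c hc0 hc1)).congr_left fun n => by ring

/-- The `z` change costs at most `√q`, rounding at most `1`, and the truncation at `Q j - 2` at most
`2`. -/
theorem abs_newDigit_sub_le (hQ : IsBasicSequence Q) {j : ℕ} (hw : w j ∈ Set.Ico (0 : ℝ) 1) :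
    |(newDigit Q W w x y z j : ℝ) - Q j * moved W w x j| ≤ (Q j).sqrt + 3 := by
  have hq := hQ j
  have hs : (Q j).sqrt ≤ Q j := Nat.sqrt_le_self _
  have hs0 : (0 : ℝ) ≤ (Q j).sqrt := Nat.cast_nonneg _
  have hw0 : 0 ≤ (Q j : ℝ) * w j := mul_nonneg (Nat.cast_nonneg _) hw.1
  have hraw1 : (rawDigit Q w j : ℝ) ≤ Q j * w j := Nat.floor_le hw0
  have hraw2 : (Q j : ℝ) * w j < rawDigit Q w j + 1 := Nat.lt_floor_add_one _
  have hraw : rawDigit Q w j ≤ Q j := by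
    have h1 : (rawDigit Q w j : ℝ) ≤ Q j := by
      nlinarith [hw.2, (Nat.cast_nonneg (Q j) : (0 : ℝ) ≤ Q j)]
    exact_mod_cast h1
  have key : ∀ v : ℕ, v ≤ Q j → |(v : ℝ) - Q j * moved W w x j| ≤ (Q j).sqrt + 1 →
      |((min (Q j - 2) v : ℕ) : ℝ) - Q j * moved W w x j| ≤ (Q j).sqrt + 3 := by
    intro v hv h1
    have h2 : ((min (Q j - 2) v : ℕ) : ℝ) ≤ v := by exact_mod_cast min_le_right _ _
    have h3 : (v : ℝ) ≤ (min (Q j - 2) v : ℕ) + 2 := by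
      have : v ≤ min (Q j - 2) v + 2 := by omega
      exact_mod_cast this
    rw [abs_le] at h1 ⊢
    constructor <;> linarith [h1.1, h1.2]
  unfold newDigit
  split_ifs with h1 h2 h3
  · refine key _ (Nat.div_le_self _ _) ?_
    rw [moved, if_pos h1]
    have h4 : 2 * (Q j / 2) ≤ Q j := by omega
    have h5 : Q j ≤ 2 * (Q j / 2) + 1 := by omega
    have h4' : (2 : ℝ) * (Q j / 2 : ℕ) ≤ Q j := by exact_mod_cast h4
    have h5' : (Q j : ℝ) ≤ 2 * (Q j / 2 : ℕ) + 1 := by exact_mod_cast h5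
    rw [abs_le]
    constructor <;> linarith
  · refine key _ hs ?_
    rw [moved, if_neg h1]
    have h4 : (rawDigit Q w j : ℝ) + 1 ≤ (Q j).sqrt := by exact_mod_cast h2.1
    rw [abs_le]
    constructor <;> linarith
  · refine key _ (by omega) ?_
    rw [moved, if_neg h1]
    rw [h3.1] at hraw2
    push_cast at *
    rw [abs_le]
    constructor <;> linarith
  · refine key _ hraw ?_
    rw [moved, if_neg h1, abs_le]
    constructor <;> linarith

theorem tendsto_sqrt_of_infiniteInLimit (hlim : InfiniteInLimit Q) :
    Tendsto (fun j => (Q j).sqrt) atTop atTop :=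
  tendsto_atTop.2 fun M => (hlim.eventually_ge_atTop (M * M)).mono fun _ h => Nat.le_sqrt.2 h

/-- Since `Q n * T Q n` is the digit plus a number in `[0, 1)`, the digit estimate divided by `Q n ≥
√q * √q` leaves at most `5 / √q`. -/
theorem tendsto_T_modified_sub_moved (h : IsGeneric Q w) (hQ : IsBasicSequence Q)
    (hlim : InfiniteInLimit Q) :
    Tendsto (fun n => T Q n (modified Q W w x y z) - moved W w x n) atTop (𝓝 0) := by
  have h1 : Tendsto (fun n => 5 / ((Q n).sqrt : ℝ)) atTop (𝓝 0) :=
    tendsto_const_nhds.div_atTop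
      (tendsto_natCast_atTop_atTop.comp (tendsto_sqrt_of_infiniteInLimit hlim))
  refine squeeze_zero_norm' ?_ h1
  filter_upwards [(tendsto_sqrt_of_infiniteInLimit hlim).eventually_ge_atTop 1] with n hn
  have hs : (1 : ℝ) ≤ (Q n).sqrt := by exact_mod_cast hn
  have hq : ((Q n).sqrt : ℝ) * (Q n).sqrt ≤ Q n := by exact_mod_cast Nat.sqrt_le (Q n)
  have hq0 : (0 : ℝ) < Q n := by nlinarith
  have h2 := T_succ Q n (modified Q W w x y z)
  rw [digit_modified hQ] at h2
  have h3 : 0 ≤ T Q (n + 1) (modified Q W w x y z) := Int.fract_nonneg _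
  have h4 : T Q (n + 1) (modified Q W w x y z) < 1 := Int.fract_lt_one _
  have h5 := abs_newDigit_sub_le (W := W) (x := x) (y := y) (z := z) hQ (h.mem_Ico n)
  have h6 : |(Q n : ℝ) * (T Q n (modified Q W w x y z) - moved W w x n)| ≤ 5 * (Q n).sqrt := by
    rw [abs_le] at h5 ⊢
    rw [mul_sub, h2]
    constructor <;> linarith [h5.1, h5.2]
  rw [abs_mul, abs_of_pos hq0] at h6
  rw [Real.norm_eq_abs, le_div_iff₀ (by linarith)]
  set D := |T Q n (modified Q W w x y z) - moved W w x n|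
  have hD : 0 ≤ D := abs_nonneg _
  have h7 : ((Q n).sqrt : ℝ) * (D * (Q n).sqrt) ≤ (Q n).sqrt * 5 := by nlinarith
  exact le_of_mul_le_mul_left h7 (by linarith)

theorem modified_mem_DNSet_iff (h : IsGeneric Q w) (hQ : IsBasicSequence Q)
    (hlim : InfiniteInLimit Q) (hW : IsWindowSequence Q W) :
    modified Q W w x y z ∈ DNSet Q ↔ Tendsto x atTop atTop := by
  have hT : ∀ n, T Q n (modified Q W w x y z) ∈ Set.Ico (0 : ℝ) 1 := fun n =>
    ⟨Int.fract_nonneg _, Int.fract_lt_one _⟩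
  have h1 := tendsto_T_modified_sub_moved (W := W) (x := x) (y := y) (z := z) h hQ hlim
  have h2 : Tendsto (fun n => moved W w x n - T Q n (modified Q W w x y z)) atTop (𝓝 0) := by
    simpa using h1.neg
  rw [← hasUniformCounts_moved_iff h hQ hW]
  constructor
  · intro hD
    have h3 : HasUniformCounts fun n => T Q n (modified Q W w x y z) :=
      UniformlyDistributedModOne.hasUniformCounts hD hT
    exact (h3.uniformlyDistributedModOne h2 (moved_mem_Ico h)).hasUniformCounts (moved_mem_Ico h)
  · intro hu
    exact hu.uniformlyDistributedModOne h1 hT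

end Distribution

end CantorSeries

end

noncomputable section

namespace CantorSeries

open Asymptotics BorelHierarchy

/-! ### The three sets are `Π⁰₃` -/

section Borel

variable {Q : ℕ → ℕ} {x : ℝ}

theorem irrational_T (hQ : IsBasicSequence Q) (hx : Irrational x) (n : ℕ) : Irrational (T Q n x) := by
  have h : partialProd Q n ≠ 0 := fun h => by
    have := partialProd_pos hQ n
    rw [h] at this
    simp at this
  exact (hx.natCast_mul h).sub_intCast _

theorem continuousAt_T (hQ : IsBasicSequence Q) (hx : Irrational x) (n : ℕ) :
    ContinuousAt (T Q n) x := by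
  have h : partialProd Q n ≠ 0 := fun h => by
    have := partialProd_pos hQ n
    rw [h] at this
    simp at this
  have hirr := hx.natCast_mul h
  have h1 : (⌊(partialProd Q n : ℝ) * x⌋ : ℝ) < partialProd Q n * x :=
    lt_of_le_of_ne (Int.floor_le _) fun h => (hirr.ne_int _) h.symm
  have hc : ContinuousAt (fun y : ℝ => (partialProd Q n : ℝ) * y) x := by fun_prop
  have h2 : (fun y => (partialProd Q n : ℝ) * y - ⌊(partialProd Q n : ℝ) * x⌋) =ᶠ[𝓝 x] T Q n := by
    filter_upwards [hc.eventually (Ioo_mem_nhds h1 (Int.lt_floor_add_one _))] with y hy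
    have : ⌊(partialProd Q n : ℝ) * y⌋ = ⌊(partialProd Q n : ℝ) * x⌋ :=
      Int.floor_eq_iff.2 ⟨hy.1.le, hy.2⟩
    rw [T, Int.fract, this]
  exact ContinuousAt.congr (by fun_prop) h2

/-- At an irrational point `T Q n` is continuous with irrational value, so `Q n * T Q n` stays off
the integers, where the floor jumps. -/
theorem eventually_digit_eq (hQ : IsBasicSequence Q) (hx : Irrational x) (n : ℕ) :
    ∀ᶠ y in 𝓝 x, digit Q y n = digit Q x n := by
  have hq : Q n ≠ 0 := by have := hQ n; omega
  have hirr := (irrational_T hQ hx n).natCast_mul hq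
  have h0 : ∀ y, 0 ≤ (Q n : ℝ) * T Q n y := fun y =>
    mul_nonneg (Nat.cast_nonneg _) (Int.fract_nonneg _)
  have h1 : (digit Q x n : ℝ) < Q n * T Q n x :=
    lt_of_le_of_ne (Nat.floor_le (h0 x)) fun h => (hirr.ne_nat _) h.symm
  have hc : ContinuousAt (fun y => (Q n : ℝ) * T Q n y) x :=
    continuousAt_const.mul (continuousAt_T hQ hx n)
  filter_upwards [hc.eventually (Ioo_mem_nhds h1 (Nat.lt_floor_add_one _))] with y hy
  exact (Nat.floor_eq_iff (h0 y)).2 ⟨hy.1.le, hy.2⟩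

theorem eventually_blockCount_eq (hQ : IsBasicSequence Q) (hx : Irrational x) {k : ℕ}
    (B : Fin k → ℕ) (n : ℕ) : ∀ᶠ y in 𝓝 x, blockCount Q B y n = blockCount Q B x n := by
  have h : ∀ᶠ y in 𝓝 x, ∀ m ∈ Finset.range (n + k), digit Q y m = digit Q x m :=
    (Finset.eventually_all _).2 fun m _ => eventually_digit_eq hQ hx m
  filter_upwards [h] with y hy
  unfold blockCount
  congr 1
  refine Finset.filter_congr fun i hi => forall_congr' fun t => ?_
  rw [hy _ (Finset.mem_range.2 (by have := Finset.mem_range.1 hi; omega))]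

theorem eventually_count_T_eq (hQ : IsBasicSequence Q) (hx : Irrational x) (c : ℚ) (n : ℕ) :
    ∀ᶠ y in 𝓝 x, count (fun i => T Q i y < c) n = count (fun i => T Q i x < c) n := by
  have h : ∀ᶠ y in 𝓝 x, ∀ i ∈ Finset.range n, (T Q i y < c ↔ T Q i x < c) := by
    refine (Finset.eventually_all _).2 fun i _ => ?_
    rcases lt_or_gt_of_ne ((irrational_T hQ hx i).ne_rat c) with h1 | h1
    · filter_upwards [(continuousAt_T hQ hx i).eventually (Iio_mem_nhds h1)] with y hy
      exact iff_of_true hy h1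
    · filter_upwards [(continuousAt_T hQ hx i).eventually (Ioi_mem_nhds h1)] with y hy
      exact iff_of_false (not_lt.2 (le_of_lt hy)) (not_lt.2 h1.le)
  filter_upwards [h] with y hy
  exact Finset.sum_congr rfl fun i hi => congrArg ind (propext (hy i hi))

theorem tendsto_one_iff_forall_nat {f : ℕ → ℝ} :
    Tendsto f atTop (𝓝 1) ↔ ∀ j : ℕ, ∃ N, ∀ n ≥ N, |f n - 1| ≤ 1 / ((j : ℝ) + 1) := by
  rw [Metric.tendsto_atTop]
  simp only [Real.dist_eq]
  constructor
  · intro h j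
    obtain ⟨N, hN⟩ := h (1 / ((j : ℝ) + 1)) (by positivity)
    exact ⟨N, fun n hn => (hN n hn).le⟩
  · intro h ε hε
    obtain ⟨j, hj⟩ := exists_nat_one_div_lt hε
    obtain ⟨N, hN⟩ := h j
    exact ⟨N, fun n hn => (hN n hn).trans_lt hj⟩

/-- The countable index set runs over blocks and tolerances `1 / (j + 1)`; the rationals form the
exceptional set. The side conditions on the block do not depend on `x` and are absorbed into the
predicate. -/
theorem piZero_NSet (hQ : IsBasicSequence Q) : PiZero 3 (NSet Q) := by
  have h := piZero_three_of_locally_decided (ι := (Σ k : ℕ, Fin k → ℕ) × ℕ)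
    (Set.countable_range ((↑) : ℚ → ℝ))
    (fun p n x => 1 ≤ p.1.1 ∧ Tendsto (fun n => expectedCount Q p.1.2 n) atTop atTop →
      |(blockCount Q p.1.2 x n : ℝ) / expectedCount Q p.1.2 n - 1| ≤ 1 / ((p.2 : ℝ) + 1))
    fun x hx p n => (eventually_blockCount_eq hQ hx p.1.2 n).mono fun y hy => by rw [hy]
  convert h using 1
  ext x
  simp only [NSet, IsNormalOfOrder, Set.mem_ofPred_eq, Prod.forall, Sigma.forall,
    tendsto_one_iff_forall_nat]
  constructor
  · intro H k B j
    by_cases hB : 1 ≤ k ∧ Tendsto (fun n => expectedCount Q B n) atTop atTop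
    · obtain ⟨N, hN⟩ := H k hB.1 B hB.2 j
      exact ⟨N, fun n hn _ => hN n hn⟩
    · exact ⟨0, fun n _ hB' => absurd hB' hB⟩
  · intro H k hk B hB j
    obtain ⟨N, hN⟩ := H k B j
    exact ⟨N, fun n hn => hN n hn ⟨hk, hB⟩⟩

theorem piZero_RNSet (hQ : IsBasicSequence Q) : PiZero 3 (RNSet Q) := by
  have h := piZero_three_of_locally_decided (ι := (Σ k : ℕ, (Fin k → ℕ) × (Fin k → ℕ)) × ℕ)
    (Set.countable_range ((↑) : ℚ → ℝ))
    (fun p n x => 1 ≤ p.1.1 ∧ Tendsto (fun n => min (expectedCount Q p.1.2.1 n)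
        (expectedCount Q p.1.2.2 n)) atTop atTop →
      |((blockCount Q p.1.2.1 x n : ℝ) / expectedCount Q p.1.2.1 n) /
        ((blockCount Q p.1.2.2 x n : ℝ) / expectedCount Q p.1.2.2 n) - 1| ≤ 1 / ((p.2 : ℝ) + 1))
    fun x hx p n => ((eventually_blockCount_eq hQ hx p.1.2.1 n).and
      (eventually_blockCount_eq hQ hx p.1.2.2 n)).mono fun y hy => by rw [hy.1, hy.2]
  convert h using 1
  ext x
  simp only [RNSet, IsRatioNormalOfOrder, Set.mem_ofPred_eq, Prod.forall, Sigma.forall,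
    tendsto_one_iff_forall_nat]
  constructor
  · intro H k B₁ B₂ j
    by_cases hB : 1 ≤ k ∧ Tendsto (fun n => min (expectedCount Q B₁ n)
      (expectedCount Q B₂ n)) atTop atTop
    · obtain ⟨N, hN⟩ := H k hB.1 B₁ B₂ hB.2 j
      exact ⟨N, fun n hn _ => hN n hn⟩
    · exact ⟨0, fun n _ hB' => absurd hB' hB⟩
  · intro H k hk B₁ B₂ hB j
    obtain ⟨N, hN⟩ := H k B₁ B₂ j
    exact ⟨N, fun n hn => hN n hn ⟨hk, hB⟩⟩

theorem piZero_DNSet (hQ : IsBasicSequence Q) : PiZero 3 (DNSet Q) := by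
  have h := piZero_three_of_locally_decided (ι := ℚ × ℕ) (Set.countable_range ((↑) : ℚ → ℝ))
    (fun p n x => 0 < p.1 ∧ p.1 < 1 →
      |count (fun i => T Q i x < p.1) n - p.1 * n| ≤ 1 / ((p.2 : ℝ) + 1) * n)
    fun x hx p n => (eventually_count_T_eq hQ hx p.1 n).mono fun y hy => by rw [hy]
  convert h using 1
  ext x
  have hT : ∀ n, T Q n x ∈ Set.Ico (0 : ℝ) 1 := fun n =>
    ⟨Int.fract_nonneg _, Int.fract_lt_one _⟩
  rw [DNSet, Set.mem_ofPred_eq, uniformlyDistributedModOne_iff hT]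
  simp only [HasUniformCounts, Set.mem_ofPred_eq, Prod.forall, isLittleO_iff, Real.norm_eq_abs,
    Nat.abs_cast]
  constructor
  · intro H c j
    by_cases hc : 0 < c ∧ c < 1
    · obtain ⟨N, hN⟩ := eventually_atTop.1
        (H c hc.1 hc.2 (show (0 : ℝ) < 1 / ((j : ℝ) + 1) by positivity))
      exact ⟨N, fun n hn _ => hN n hn⟩
    · exact ⟨0, fun n _ hc' => absurd hc' hc⟩
  · intro H c hc0 hc1 ε hε
    obtain ⟨j, hj⟩ := exists_nat_one_div_lt hε
    obtain ⟨N, hN⟩ := H c j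
    filter_upwards [eventually_ge_atTop N] with n hn
    exact (hN n hn ⟨hc0, hc1⟩).trans (mul_le_mul_of_nonneg_right hj.le (Nat.cast_nonneg n))

end Borel

theorem continuous_modified {Q : ℕ → ℕ} (hQ : IsBasicSequence Q) (W : ℕ → ℕ) (w : ℕ → ℝ) :
    Continuous fun p : (ℕ → ℕ) × (ℕ → ℕ) × (ℕ → ℕ) => modified Q W w p.1 p.2.1 p.2.2 :=
  continuous_realize hQ (fun p i => by
    have := newDigit_add_two_le (Q := Q) (W := W) (w := w) (x := p.1) (y := p.2.1) (z := p.2.2) hQ i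
    omega) fun i => continuous_newDigit Q W w i

end CantorSeries

end

theorem theorem5 (Q : ℕ → ℕ) (hQ : CantorSeries.IsBasicSequence Q)
    (hlim : CantorSeries.InfiniteInLimit Q) (hdiv : CantorSeries.KDivergent Q 1) :
    BorelHierarchy.IsD2Pi3Complete (CantorSeries.DNSet Q \ CantorSeries.NSet Q) ∧
    BorelHierarchy.IsD2Pi3Complete (CantorSeries.DNSet Q \ CantorSeries.RNSet Q) ∧
    BorelHierarchy.IsD2Pi3Complete (CantorSeries.NSet Q \ CantorSeries.DNSet Q) ∧
    BorelHierarchy.IsD2Pi3Complete (CantorSeries.RNSet Q \ CantorSeries.DNSet Q) ∧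
    BorelHierarchy.IsD2Pi3Complete (CantorSeries.RNSet Q \ CantorSeries.NSet Q) := by
  obtain ⟨w, hw⟩ := CantorSeries.exists_isGeneric hlim
  obtain ⟨W, hW⟩ := CantorSeries.exists_isWindowSequence Q
  have hN := CantorSeries.piZero_NSet hQ
  have hRN := CantorSeries.piZero_RNSet hQ
  have hDN := CantorSeries.piZero_DNSet hQ
  have hc := CantorSeries.continuous_modified hQ W w
  have mN := fun x y z : ℕ → ℕ =>
    CantorSeries.modified_mem_NSet_iff (x := x) (y := y) (z := z) hw hQ hlim hdiv hW
  have mRN := fun x y z : ℕ → ℕ =>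
    CantorSeries.modified_mem_RNSet_iff (x := x) (y := y) (z := z) hw hQ hlim hdiv hW
  have mDN := fun x y z : ℕ → ℕ =>
    CantorSeries.modified_mem_DNSet_iff (x := x) (y := y) (z := z) hw hQ hlim hW
  -- The sequence `n ↦ n` makes a modification negligible and serves for the parameter not in use.
  have hid : Tendsto (fun n : ℕ => n) atTop atTop := tendsto_id
  have c1 : Continuous fun p : ℕ → ℕ × ℕ => fun n => (p n).1 := by fun_prop
  have c2 : Continuous fun p : ℕ → ℕ × ℕ => fun n => (p n).2 := by fun_prop
  have c3 : Continuous fun _ : ℕ → ℕ × ℕ => fun n : ℕ => n := continuous_const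
  refine ⟨⟨⟨_, _, hDN, hN, rfl⟩, ?_⟩, ⟨⟨_, _, hDN, hRN, rfl⟩, ?_⟩, ⟨⟨_, _, hN, hDN, rfl⟩, ?_⟩,
    ⟨⟨_, _, hRN, hDN, rfl⟩, ?_⟩, ⟨⟨_, _, hRN, hN, rfl⟩, ?_⟩⟩
  -- With `z` negligible, `y` alone decides both normality and ratio normality, and `x` decides
  -- distribution normality. For the reversed differences `x` and `y` exchange roles.
  · exact BorelHierarchy.isD2Pi3Hard_of_continuous _ (hc.comp (c1.prodMk (c2.prodMk c3))) fun p => by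
      simp only [Function.comp_apply, Set.mem_sdiff, mN, mDN, hid, and_true]
  · exact BorelHierarchy.isD2Pi3Hard_of_continuous _ (hc.comp (c1.prodMk (c2.prodMk c3))) fun p => by
      simp only [Function.comp_apply, Set.mem_sdiff, mRN, mDN]
  · exact BorelHierarchy.isD2Pi3Hard_of_continuous _ (hc.comp (c2.prodMk (c1.prodMk c3))) fun p => by
      simp only [Function.comp_apply, Set.mem_sdiff, mN, mDN, hid, and_true]
  · exact BorelHierarchy.isD2Pi3Hard_of_continuous _ (hc.comp (c2.prodMk (c1.prodMk c3))) fun p => by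
      simp only [Function.comp_apply, Set.mem_sdiff, mRN, mDN]
  -- Here `x` is idle: the first coordinate goes into `y`, which decides ratio normality, and the
  -- second into `z`, which can only destroy normality.
  · exact BorelHierarchy.isD2Pi3Hard_of_continuous _ (hc.comp (c3.prodMk (c1.prodMk c2))) fun p => by
      simp only [Function.comp_apply, Set.mem_sdiff, mRN, mN]
      tauto
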